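/- Work in continuous logic with a countable one-sorted continuous signature $L$ whose metric and predicates take values in $[0,1]$; $L$-structures are nonempty complete metric spaces of diameter at most $1$ with interpretations of the symbols of $L$ respecting the prescribed moduli of uniform continuity. An $L$-theory is a set of closed conditions $\sigma=0$ with $\sigma$ an $L$-sentence. Let $C$ be a countably infinite set of new constant symbols. Given a satisfiable $L$-theory $T$, a \emph{condition} is a finite set $p$ of expressions $\varphi<r$, where $r\in\mathbb R$ and $\varphi$ is a quantifier-free $L(C)$-sentence built from atomic sentences using only the connectives $x\mapsto x/2$, $x\mapsto 1-x$ and $(x,y)\mapsto\min(x+y,1)$, such that $T\cup p$ is satisfiable. Two players $\forall$ and $\exists$ alternately play conditions $p_0\subseteq p_1\subseteq p_2\subseteq\cdots$, with $\forall$ playing $p_0$; let $\bar p=\bigcup_n p_n$. The play is \emph{definitive} if for every atomic $L(C)$-sentence $\varphi$ there is a unique $r\in[0,1]$ such that $T\cup\bar p\models\varphi=r$; then the \emph{compiled structure} $A^+(\bar p)$ is the completion of the $L(C)$-prestructure on the set of closed $L(C)$-terms in which the atomic sentences have these values. A property $P$ of $L(C)$-structures (invariant under isomorphism) is \emph{enforceable}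 if $\exists$ has a strategy guaranteeing that the play is definitive and the compiled structure has $P$. An \emph{enforceable model} of $T$ is a model $A$ of $T$ such that the property ``the $L$-reduct is isomorphic to $A$'' is enforceable. We say that a model of $T$ has a property $P$ of $L(C)$-structures if some expansion of it to an $L(C)$-structure has $P$. The theory $T$ is \emph{$\forall\exists$-axiomatizable} if it has the same models as a set of conditions of the form $\sup_x\inf_y\varphi(x,y)=0$ with $x,y$ finite tuples and $\varphi$ quantifier-free, and it has the \emph{joint embedding property} (JEP) if any two models of $T$ embed into a common model of $T$. \textbf{Theorem.} Let $T$ be a satisfiable $\forall\exists$-axiomatizable $L$-theory with JEP. Then exactly one of the following holds: \begin{enumerate} \item for every enforceable property $P$, the separable models of $T$ with property $P$ form exactly $2^{\aleph_0}$ isomorphism classes of $L$-structures; \item $T$ has an enforceable model. \end{enumerate} -/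

import Mathlib

open scoped unitInterval

universe u w

namespace ContLogic

/-! ### Continuous logic

Signatures are one-sorted; the metric and all predicates take values in `[0,1]`. -/

/-- A continuous signature: a first-order language (function symbols of arity `0` are the
constants, relation symbols are the predicate symbols) together with a modulus of uniform
continuity for every symbol. -/
structure Signature extends FirstOrder.Language.{u, u} where
  funModulus : ∀ {n : ℕ}, Functions n → ℝ → ℝ
  relModulus : ∀ {n : ℕ}, Relations n → ℝ → ℝ
  funModulus_pos : ∀ {n : ℕ} (f : Functions n) (ε : ℝ), 0 < ε → 0 < funModulus f ε
  relModulus_pos : ∀ {n : ℕ} (R : Relations n) (ε : ℝ), 0 < ε → 0 < relModulus R ε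

/-- An `L`-structure: a nonempty complete metric space of diameter at most `1` with
interpretations of the symbols that respect the moduli (`Fin n → carrier` has the maximum
metric). -/
structure Str (L : Signature.{u}) where
  carrier : Type u
  [metric : MetricSpace carrier]
  [complete : CompleteSpace carrier]
  [nonempty : Nonempty carrier]
  dist_le_one : ∀ x y : carrier, dist x y ≤ 1
  funMap : ∀ {n : ℕ}, L.Functions n → (Fin n → carrier) → carrier
  relMap : ∀ {n : ℕ}, L.Relations n → (Fin n → carrier) → I
  funMap_modulus : ∀ {n : ℕ} (f : L.Functions n) (ε : ℝ), 0 < ε → ∀ x y : Fin n → carrier,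
    dist x y < L.funModulus f ε → dist (funMap f x) (funMap f y) ≤ ε
  relMap_modulus : ∀ {n : ℕ} (R : L.Relations n) (ε : ℝ), 0 < ε → ∀ x y : Fin n → carrier,
    dist x y < L.relModulus R ε → dist (relMap R x) (relMap R y) ≤ ε

attribute [instance] Str.metric Str.complete Str.nonempty

/-- Formulas with free variables from `α` and from `x₀, …, xₙ₋₁`. Every continuous function
`[0,1]^k → [0,1]` is a connective; a quantifier on a formula with variables `x₀, …, xₙ` binds
the last variable `xₙ`. -/
inductive Formula (L : Signature.{u}) (α : Type w) : ℕ → Type (max u w)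
  | rel {n k : ℕ} (R : L.Relations k) (ts : Fin k → L.Term (α ⊕ Fin n)) : Formula L α n
  | dist {n : ℕ} (s t : L.Term (α ⊕ Fin n)) : Formula L α n
  | conn {n k : ℕ} (c : C(Fin k → I, I)) (φs : Fin k → Formula L α n) : Formula L α n
  | sup {n : ℕ} (φ : Formula L α (n + 1)) : Formula L α n
  | inf {n : ℕ} (φ : Formula L α (n + 1)) : Formula L α n

namespace Str

/-- Value of a term in a structure. -/
def termVal {L : Signature.{u}} (M : Str L) {β : Type w} (v : β → M.carrier) :
    L.Term β → M.carrier
  | .var x => v x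
  | .func f ts => M.funMap f fun i => M.termVal v (ts i)

/-- Value of a formula in a structure. Suprema and infima are those of the complete lattice
`[0,1]`. -/
noncomputable def val {L : Signature.{u}} (M : Str L) {α : Type w} (v : α → M.carrier) :
    {n : ℕ} → Formula L α n → (Fin n → M.carrier) → I
  | _, .rel R ts, x => M.relMap R fun i => M.termVal (Sum.elim v x) (ts i)
  | _, .dist s t, x =>
      ⟨Dist.dist (M.termVal (Sum.elim v x) s) (M.termVal (Sum.elim v x) t),
        dist_nonneg, M.dist_le_one _ _⟩
  | _, .conn c φs, x => c fun i => M.val v (φs i) x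
  | _, .sup φ, x => ⨆ a : M.carrier, M.val v φ (Fin.snoc x a)
  | _, .inf φ, x => ⨅ a : M.carrier, M.val v φ (Fin.snoc x a)

end Str

/-- The connective `¬ r = 1 - r`. -/
def negConn : C(Fin 1 → I, I) where
  toFun r := σ (r 0)
  continuous_toFun := unitInterval.continuous_symm.comp (continuous_apply 0)

/-- The connective `r / 2`. -/
noncomputable def halfConn : C(Fin 1 → I, I) where
  toFun r := ⟨(r 0 : ℝ) / 2, by have := (r 0).2.1; positivity,
    by have := (r 0).2.2; linarith⟩
  continuous_toFun := by fun_prop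

/-- Truncated addition `min (r + s) 1`. -/
noncomputable def addConn : C(Fin 2 → I, I) where
  toFun r := ⟨min ((r 0 : ℝ) + r 1) 1,
    le_min (add_nonneg (r 0).2.1 (r 1).2.1) zero_le_one, min_le_right _ _⟩
  continuous_toFun := by fun_prop

namespace Formula

variable {L : Signature.{u}} {α : Type w}

/-- Atomic formulas. -/
inductive IsAtomic : {n : ℕ} → Formula L α n → Prop
  | rel {n k : ℕ} (R : L.Relations k) (ts : Fin k → L.Term (α ⊕ Fin n)) : IsAtomic (.rel R ts)
  | dist {n : ℕ} (s t : L.Term (α ⊕ Fin n)) : IsAtomic (.dist s t)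

/-- Quantifier-free formulas. -/
inductive IsQF : {n : ℕ} → Formula L α n → Prop
  | atomic {n : ℕ} {φ : Formula L α n} : IsAtomic φ → IsQF φ
  | conn {n k : ℕ} (c : C(Fin k → I, I)) {φs : Fin k → Formula L α n} :
      (∀ i, IsQF (φs i)) → IsQF (.conn c φs)

/-- Restricted quantifier-free formulas: the only connectives are `r / 2`, `1 - r` and truncated
addition. -/
inductive IsRestrictedQF : {n : ℕ} → Formula L α n → Prop
  | atomic {n : ℕ} {φ : Formula L α n} : IsAtomic φ → IsRestrictedQF φ
  | neg {n : ℕ} {φs : Fin 1 → Formula L α n} :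
      (∀ i, IsRestrictedQF (φs i)) → IsRestrictedQF (.conn negConn φs)
  | half {n : ℕ} {φs : Fin 1 → Formula L α n} :
      (∀ i, IsRestrictedQF (φs i)) → IsRestrictedQF (.conn halfConn φs)
  | add {n : ℕ} {φs : Fin 2 → Formula L α n} :
      (∀ i, IsRestrictedQF (φs i)) → IsRestrictedQF (.conn addConn φs)

/-- Existential formulas `inf_y φ` with `φ` quantifier-free and `y` a finite tuple. -/
inductive IsExistential : {n : ℕ} → Formula L α n → Prop
  | qf {n : ℕ} {φ : Formula L α n} : IsQF φ → IsExistential φ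
  | inf {n : ℕ} {φ : Formula L α (n + 1)} : IsExistential φ → IsExistential (.inf φ)

/-- `∀∃`-formulas `sup_x inf_y φ` with `φ` quantifier-free and `x`, `y` finite tuples. -/
inductive IsForallExists : {n : ℕ} → Formula L α n → Prop
  | ex {n : ℕ} {φ : Formula L α n} : IsExistential φ → IsForallExists φ
  | sup {n : ℕ} {φ : Formula L α (n + 1)} : IsForallExists φ → IsForallExists (.sup φ)

end Formula

/-- `L`-sentences. -/
abbrev Sentence (L : Signature.{u}) := Formula L Empty 0

/-- A theory is a set of sentences; `σ ∈ T` stands for the closed condition `σ = 0`. -/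
abbrev Theory (L : Signature.{u}) := Set (Sentence L)

/-- `M ⊨ T`. -/
def Str.Models {L : Signature.{u}} (M : Str L) (T : Theory L) : Prop :=
  ∀ φ ∈ T, M.val Empty.elim φ Fin.elim0 = 0

/-- `T` has a model. -/
def Theory.Satisfiable {L : Signature.{u}} (T : Theory L) : Prop :=
  ∃ M : Str L, M.Models T

/-- `T` has the same models as some set of conditions `σ = 0` with `σ` a `∀∃`-sentence. -/
def Theory.ForallExistsAxiomatizable {L : Signature.{u}} (T : Theory L) : Prop :=
  ∃ T' : Theory L, (∀ φ ∈ T', φ.IsForallExists) ∧ ∀ M : Str L, M.Models T ↔ M.Models T'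

/-- Embeddings of structures: isometric maps preserving the values of all symbols. -/
structure Embedding {L : Signature.{u}} (M N : Str L) where
  toFun : M.carrier → N.carrier
  isometry : Isometry toFun
  map_fun : ∀ {n : ℕ} (f : L.Functions n) (x : Fin n → M.carrier),
    toFun (M.funMap f x) = N.funMap f (toFun ∘ x)
  map_rel : ∀ {n : ℕ} (R : L.Relations n) (x : Fin n → M.carrier),
    N.relMap R (toFun ∘ x) = M.relMap R x

/-- `M ≅ N`: there is a surjective embedding. -/
def Isomorphic {L : Signature.{u}} (M N : Str L) : Prop :=
  ∃ e : Embedding M N, Function.Surjective e.toFun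

/-- The joint embedding property: any two models of `T` embed into a common model of `T`. -/
def Theory.JEP {L : Signature.{u}} (T : Theory L) : Prop :=
  ∀ M N : Str L, M.Models T → N.Models T →
    ∃ K : Str L, K.Models T ∧ Nonempty (Embedding M K) ∧ Nonempty (Embedding N K)

/-! ### The game

The set `C` of new constant symbols is `ℕ`. An `L(C)`-structure is an `L`-structure with an
interpretation `ℕ → carrier` of the new constants; closed `L(C)`-terms and `L(C)`-sentences are
`L`-terms and `L`-formulas in which the elements of `C = ℕ` occur in the places of free
variables. -/

/-- `L(C)`-structures. -/
structure StrC (L : Signature.{u}) where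
  reduct : Str L
  const : ℕ → reduct.carrier

/-- `L(C)`-sentences. -/
abbrev SentenceC (L : Signature.{u}) := Formula L ℕ 0

/-- Value of an `L(C)`-sentence. -/
noncomputable def StrC.val {L : Signature.{u}} (A : StrC L) (φ : SentenceC L) : I :=
  A.reduct.val A.const φ Fin.elim0

/-- Expressions `φ < r` with `φ` a restricted quantifier-free `L(C)`-sentence. -/
structure OpenExpr (L : Signature.{u}) where
  φ : SentenceC L
  restricted : φ.IsRestrictedQF
  r : ℝ

/-- `A⁺ ⊨ T ∪ S`, for a set `S` of expressions `φ < r`. -/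
def StrC.Models {L : Signature.{u}} (A : StrC L) (T : Theory L) (S : Set (OpenExpr L)) : Prop :=
  A.reduct.Models T ∧ ∀ e ∈ S, (A.val e.φ : ℝ) < e.r

/-- Conditions: finite sets `p` of expressions `φ < r` such that `T ∪ p` is satisfiable. -/
structure Condition {L : Signature.{u}} (T : Theory L) where
  exprs : Set (OpenExpr L)
  finite : exprs.Finite
  satisfiable : ∃ A : StrC L, A.Models T exprs

/-- `T ∪ S ⊨ φ = r`. -/
def Entails {L : Signature.{u}} (T : Theory L) (S : Set (OpenExpr L)) (φ : SentenceC L)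
    (r : I) : Prop :=
  ∀ A : StrC L, A.Models T S → A.val φ = r

/-- `S` is definitive: for every atomic `L(C)`-sentence `φ` there is a unique `r` with
`T ∪ S ⊨ φ = r`. -/
def Definitive {L : Signature.{u}} (T : Theory L) (S : Set (OpenExpr L)) : Prop :=
  ∀ φ : SentenceC L, φ.IsAtomic → ∃! r : I, Entails T S φ r

/-- `A⁺` is the structure compiled from a definitive `S`, i.e. the completion of the prestructure
on the set of closed `L(C)`-terms which gives every atomic `L(C)`-sentence the value determined by
`T ∪ S`: the (complete) structure `A⁺` gives atomic sentences these values, and the interpretations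
of closed `L(C)`-terms are dense in it. This determines `A⁺` up to a unique isomorphism. -/
def IsCompiled {L : Signature.{u}} (T : Theory L) (S : Set (OpenExpr L)) (A : StrC L) : Prop :=
  (∀ φ : SentenceC L, φ.IsAtomic → ∀ r : I, Entails T S φ r → A.val φ = r) ∧
    DenseRange (fun t : L.Term ℕ => A.reduct.termVal A.const t)

/-- The outcome `p₀ ⊆ p₁ ⊆ p₂ ⊆ ⋯` is won by `∃` in the game `G(P)`: the union of the `pₙ` is
definitive and the compiled structure has property `P`. -/
def WonByExists {L : Signature.{u}} (T : Theory L) (P : StrC L → Prop)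
    (p : ℕ → Condition T) : Prop :=
  Definitive T (⋃ n, (p n).exprs) ∧ ∃ A : StrC L, IsCompiled T (⋃ n, (p n).exprs) A ∧ P A

/-- `P` is enforceable: player `∃` has a winning strategy in `G(P)`. Player `∀` chooses
`p₀, p₂, p₄, …` and player `∃` chooses `p₁, p₃, p₅, …`; a strategy `s` for `∃` computes the next
move from the list of all previous moves. It is winning if, in every run in which `∃` follows `s`
and `∀` obeys the rule that each move extends the previous one, `∃` obeys this rule too and the
outcome is won by `∃`. -/
def Enforceable {L : Signature.{u}} (T : Theory L) (P : StrC L → Prop) : Prop :=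
  ∃ s : List (Condition T) → Condition T, ∀ p : ℕ → Condition T,
    (∀ k, p (2 * k + 1) = s ((List.range (2 * k + 1)).map p)) →
    (∀ k, (p (2 * k + 1)).exprs ⊆ (p (2 * k + 2)).exprs) →
    (∀ k, (p (2 * k)).exprs ⊆ (p (2 * k + 1)).exprs) ∧ WonByExists T P p

/-- `M` is an enforceable structure: it is enforceable that the reduct of the compiled structure is
isomorphic to `M`. -/
def EnforceableStr {L : Signature.{u}} (T : Theory L) (M : Str L) : Prop :=
  Enforceable T fun A => Isomorphic A.reduct M

/-- The isomorphism class of a structure. -/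
def isoClass {L : Signature.{u}} (M : Str L) : Set (Str L) :=
  {N | Isomorphic M N}

/-- The set of isomorphism classes of separable models of `T` with property `P`. As `P` is a
property of `L(C)`-structures, a model has `P` if some interpretation of the new constants in it
does. -/
def isoClassesWith {L : Signature.{u}} (T : Theory L) (P : StrC L → Prop) : Set (Set (Str L)) :=
  {K | ∃ A : StrC L, A.reduct.Models T ∧ TopologicalSpace.SeparableSpace A.reduct.carrier ∧
    P A ∧ K = isoClass A.reduct}

end ContLogic

/-! An `L(C)`-structure is recorded by its diagram, the point of the compact metrizable space `Atom
L → I` listing all atomic values. Up to refinement, conditions are open sets meeting `modelDiagrams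
T`, so the game is a Banach–Mazur game on diagrams. Player `∃` can enforce countably many relatively
dense open requirements (`enforceable_of_denseInModels`), and player `∀` can impose them against any
strategy.

The sets `decidingSet` are such requirements: an approximate existential statement about the
constants is either realized by constants or refuted, in all models of `T`, by an open part of the
diagram. A structure meeting all of them has dense constants and satisfies the `∀∃`-consequences of
`T`, hence is a model of `T` (`IsDeciding.models`).

Call an open `U` good for `(n, ε)` if any two consistent open parts of it are realized in one model
of `T` by sequences whose first `n` entries are `ε`-close.

If good sets are dense for all `(n, ε)`, then it is enforceable that the compiled structure is
generic, i.e. deciding with good neighbourhoods of its diagram. Goodness is an approximate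
amalgamation property, and JEP starts an approximate back-and-forth, so any two generic structures
are isomorphic (`IsGeneric.isomorphic`). This gives an enforceable model.

Otherwise, for some `(n, ε)`, no consistent open part of some consistent `V` is good. Against any
strategy for `∃`, player `∀` splits at every move into two conditions that no model of `T` realizes
by sequences `ε`-close in their first `n` entries. The resulting Cantor scheme gives models with the
enforced property, and copies of their constants inside one model are pairwise `ε`-separated.
Separability makes each isomorphism class contain only countably many of them
(`continuum_le_mk_isoClassesWith`). -/

namespace ContLogic

/-! ### Diagrams of atomic sentences -/

open Topology Set

variable {L : Signature.{u}}

/-- Atomic `L(C)`-sentences, for `C = ℕ`. -/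
abbrev Atom (L : Signature.{u}) : Type u :=
  (L.Term ℕ × L.Term ℕ) ⊕ (Σ k, L.Relations k × (Fin k → L.Term ℕ))

/-- Renaming of the constants in an atomic sentence. -/
def Atom.relabel (g : ℕ → ℕ) : Atom L → Atom L
  | .inl (s, t) => .inl (s.relabel g, t.relabel g)
  | .inr ⟨k, R, ts⟩ => .inr ⟨k, R, fun i => (ts i).relabel g⟩

/-- An atomic sentence as a formula. -/
def Atom.toFormula : Atom L → SentenceC L
  | .inl (s, t) => .dist (s.relabel Sum.inl) (t.relabel Sum.inl)
  | .inr ⟨_, R, ts⟩ => .rel R fun i => (ts i).relabel Sum.inl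

theorem Atom.toFormula_isAtomic (a : Atom L) : a.toFormula.IsAtomic := by
  rcases a with ⟨s, t⟩ | ⟨k, R, ts⟩
  · exact .dist _ _
  · exact .rel _ _

theorem countable_atom (hL : Countable L.Symbols) : Countable (Atom L) := by
  have h1 : Countable (Σ l, L.Functions l) :=
    Function.Injective.countable (f := (Sum.inl : _ → L.Symbols)) Sum.inl_injective
  have h2 : Countable (Σ l, L.Relations l) :=
    Function.Injective.countable (f := (Sum.inr : _ → L.Symbols)) Sum.inr_injective
  have h3 : Countable (L.Term ℕ) := by
    have := Encodable.ofCountable (Σ l, L.Functions l)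
    exact Encodable.countable
  have h4 : ∀ k, Countable (L.Relations k) := fun k =>
    Function.Injective.countable (f := (Sigma.mk k : _ → Σ l, L.Relations l)) sigma_mk_injective
  infer_instance

/-! ### Continuity of atomic values, quantifier-free formulas and existential formulas. -/

namespace Str

variable (M : Str L)

/-- The values of all atomic sentences under an interpretation `v` of the constants. -/
def diagram (v : ℕ → M.carrier) : Atom L → I
  | .inl (s, t) => ⟨dist (M.termVal v s) (M.termVal v t), dist_nonneg, M.dist_le_one _ _⟩
  | .inr ⟨_, R, ts⟩ => M.relMap R fun i => M.termVal v (ts i)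

theorem termVal_relabel {β γ : Type*} (v : γ → M.carrier) (g : β → γ) (t : L.Term β) :
    M.termVal v (t.relabel g) = M.termVal (v ∘ g) t := by
  induction t with
  | var x => rfl
  | func f ts ih => simp only [FirstOrder.Language.Term.relabel, termVal, ih]

theorem diagram_comp (v : ℕ → M.carrier) (g : ℕ → ℕ) :
    M.diagram (v ∘ g) = M.diagram v ∘ Atom.relabel g := by
  funext a
  rcases a with ⟨s, t⟩ | ⟨k, R, ts⟩ <;> simp [diagram, Atom.relabel, termVal_relabel]

theorem uniformContinuous_funMap {n : ℕ} (f : L.Functions n) : UniformContinuous (M.funMap f) := by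
  refine Metric.uniformContinuous_iff.2 fun ε hε => ?_
  refine ⟨_, L.funModulus_pos f (ε / 2) (by positivity), fun {x y} h => ?_⟩
  linarith [M.funMap_modulus f (ε / 2) (by positivity) x y h]

theorem continuous_funMap {n : ℕ} (f : L.Functions n) : Continuous (M.funMap f) :=
  (M.uniformContinuous_funMap f).continuous

theorem uniformContinuous_relMap {n : ℕ} (R : L.Relations n) : UniformContinuous (M.relMap R) := by
  refine Metric.uniformContinuous_iff.2 fun ε hε => ?_
  refine ⟨_, L.relModulus_pos R (ε / 2) (by positivity), fun {x y} h => ?_⟩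
  linarith [M.relMap_modulus R (ε / 2) (by positivity) x y h]

theorem uniformContinuous_termVal {β : Type*} (t : L.Term β) :
    UniformContinuous fun v : β → M.carrier => M.termVal v t := by
  induction t with
  | var x => exact Pi.uniformContinuous_proj _ x
  | func f ts ih => exact (M.uniformContinuous_funMap f).comp (uniformContinuous_pi.2 ih)

/-- This allows a sequence to be moved into a dense set, or to be changed beyond a finite initial
segment, without leaving an open set of diagrams. -/
theorem continuous_diagram : Continuous M.diagram := by
  refine continuous_pi fun a => ?_
  rcases a with ⟨s, t⟩ | ⟨k, R, ts⟩
  · exact Continuous.subtype_mk ((M.uniformContinuous_termVal s).continuous.dist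
      (M.uniformContinuous_termVal t).continuous) _
  · exact (M.uniformContinuous_relMap R).continuous.comp
      (continuous_pi fun i => (M.uniformContinuous_termVal (ts i)).continuous)

theorem uniformContinuous_val_of_isQF {α : Type w} (v : α → M.carrier) {n : ℕ} {φ : Formula L α n}
    (h : φ.IsQF) : UniformContinuous (M.val v φ) := by
  have key : ∀ {n : ℕ} (t : L.Term (α ⊕ Fin n)),
      UniformContinuous fun x : Fin n → M.carrier => M.termVal (Sum.elim v x) t := by
    intro n t
    refine (M.uniformContinuous_termVal t).comp (uniformContinuous_pi.2 ?_)
    rintro (a | i)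
    · exact uniformContinuous_const
    · exact Pi.uniformContinuous_proj _ i
  induction h with
  | atomic h =>
    cases h with
    | rel R ts =>
      exact (M.uniformContinuous_relMap R).comp (uniformContinuous_pi.2 fun i => key (ts i))
    | dist s t => exact ((key s).dist (key t)).subtype_mk _
  | conn c _ ih =>
    exact (CompactSpace.uniformContinuous_of_continuous c.continuous).comp
      (uniformContinuous_pi.2 ih)

/-- Appending the same last entry to two tuples does not increase their maximum distance, so a
modulus for `F` survives the infimum. -/
theorem uniformContinuous_iInf_snoc {Y : Type*} [MetricSpace Y] {n : ℕ}
    {F : (Fin (n + 1) → Y) → I} (hF : UniformContinuous F) :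
    UniformContinuous fun x : Fin n → Y => ⨅ a : Y, F (Fin.snoc x a) := by
  rw [Metric.uniformContinuous_iff] at hF ⊢
  intro ε hε
  obtain ⟨δ, hδ, H⟩ := hF (ε / 2) (by positivity)
  have key : ∀ x y : Fin n → Y, dist x y < δ →
      ((⨅ a : Y, F (Fin.snoc x a) : I) : ℝ) ≤ ((⨅ a : Y, F (Fin.snoc y a) : I) : ℝ) + ε / 2 := by
    intro x y hxy
    by_contra! hlt
    set r : ℝ := ((⨅ a : Y, F (Fin.snoc x a) : I) : ℝ) - ε / 2 with hr
    have hr0 : 0 ≤ r := by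
      have := (⨅ a : Y, F (Fin.snoc y a) : I).2.1
      linarith
    have hr1 : r ≤ 1 := by
      have := (⨅ a : Y, F (Fin.snoc x a) : I).2.2
      linarith
    have h1 : (⨅ a : Y, F (Fin.snoc y a) : I) < ⟨r, hr0, hr1⟩ := by
      rw [← Subtype.coe_lt_coe]; change _ < r; linarith
    obtain ⟨a, ha⟩ := iInf_lt_iff.1 h1
    have h2 : dist (Fin.snoc x a : Fin (n + 1) → Y) (Fin.snoc y a) < δ := by
      rw [dist_pi_lt_iff hδ]
      refine Fin.lastCases ?_ fun i => ?_
      · simpa using hδ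
      · simpa using (dist_pi_lt_iff hδ).1 hxy i
    have h3 := H h2
    rw [Subtype.dist_eq, Real.dist_eq, abs_lt] at h3
    have h4 : ((⨅ a : Y, F (Fin.snoc x a) : I) : ℝ) ≤ F (Fin.snoc x a) :=
      Subtype.coe_le_coe.2 (iInf_le _ a)
    have h5 : (F (Fin.snoc y a) : ℝ) < r := Subtype.coe_lt_coe.2 ha
    linarith
  refine ⟨δ, hδ, fun {x y} hxy => ?_⟩
  rw [Subtype.dist_eq, Real.dist_eq, abs_lt]
  have h1 := key x y hxy
  have h2 := key y x (by rwa [dist_comm])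
  constructor <;> linarith

theorem uniformContinuous_val_of_isExistential {α : Type w} (v : α → M.carrier) {n : ℕ}
    {φ : Formula L α n} (h : φ.IsExistential) : UniformContinuous (M.val v φ) := by
  induction h with
  | qf h => exact M.uniformContinuous_val_of_isQF v h
  | inf _ ih => exact uniformContinuous_iInf_snoc ih

end Str

theorem continuous_comp_relabel (g : ℕ → ℕ) :
    Continuous fun x : Atom L → I => x ∘ Atom.relabel g :=
  continuous_pi fun a => continuous_apply (Atom.relabel g a)

/-- An open condition on a sequence depends only on a finite part of it. -/
theorem exists_forall_lt_mem_of_isOpen {Y : Type*} [TopologicalSpace Y] {O : Set (ℕ → Y)}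
    (hO : IsOpen O) {v : ℕ → Y} (hv : v ∈ O) :
    ∃ K : ℕ, ∀ u : ℕ → Y, (∀ i < K, u i = v i) → u ∈ O := by
  obtain ⟨J, U, hU, hsub⟩ := isOpen_pi_iff.1 hO v hv
  refine ⟨J.sup id + 1, fun u hu => hsub fun i hi => ?_⟩
  have : i ≤ J.sup id := Finset.le_sup (f := id) hi
  rw [hu i (by omega)]
  exact (hU i hi).2

theorem Formula.IsRestrictedQF.isQF {α : Type w} {n : ℕ} {φ : Formula L α n}
    (h : φ.IsRestrictedQF) : φ.IsQF := by
  induction h with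
  | atomic h => exact .atomic h
  | neg _ ih => exact .conn _ ih
  | half _ ih => exact .conn _ ih
  | add _ ih => exact .conn _ ih

/-- The value of a quantifier-free formula is a continuous function of the atomic values. -/
theorem Formula.IsQF.exists_continuous {α : Type w} {n : ℕ} {φ : Formula L α n} (h : φ.IsQF)
    (ρ : α ⊕ Fin n → ℕ) : ∃ F : (Atom L → I) → I, Continuous F ∧
      ∀ (M : Str L) (v : ℕ → M.carrier),
        M.val (fun a => v (ρ (.inl a))) φ (fun i => v (ρ (.inr i))) = F (M.diagram v) := by
  have key : ∀ {n : ℕ} (ρ : α ⊕ Fin n → ℕ) (M : Str L) (v : ℕ → M.carrier),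
      Sum.elim (fun a => v (ρ (.inl a))) (fun i => v (ρ (.inr i))) = v ∘ ρ := by
    intro n ρ M v
    funext x
    rcases x with a | i <;> rfl
  induction h with
  | atomic h =>
    cases h with
    | rel R ts =>
      refine ⟨fun x => x (.inr ⟨_, R, fun i => (ts i).relabel ρ⟩), continuous_apply _,
        fun M v => ?_⟩
      simp only [Str.val, Str.diagram, key, Str.termVal_relabel]
    | dist s t =>
      refine ⟨fun x => x (.inl (s.relabel ρ, t.relabel ρ)), continuous_apply _, fun M v => ?_⟩
      simp only [Str.val, Str.diagram, key, Str.termVal_relabel]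
  | conn c _ ih =>
    choose F hF hv using ih
    refine ⟨fun x => c fun i => F i x, c.continuous.comp (continuous_pi hF), fun M v => ?_⟩
    simp only [Str.val, hv]

/-- The values of the atomic sentences in an `L(C)`-structure. -/
def StrC.diagram (A : StrC L) : Atom L → I := A.reduct.diagram A.const

theorem StrC.exists_continuous_val {φ : SentenceC L} (h : φ.IsQF) :
    ∃ F : (Atom L → I) → I, Continuous F ∧ ∀ A : StrC L, A.val φ = F A.diagram := by
  obtain ⟨F, hF, hv⟩ := h.exists_continuous (Sum.elim id Fin.elim0)
  refine ⟨F, hF, fun A => ?_⟩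
  rw [StrC.diagram, ← hv, StrC.val]
  congr
  exact Subsingleton.elim _ _

theorem StrC.val_eq_of_diagram_eq {φ : SentenceC L} (h : φ.IsQF) {A B : StrC L}
    (hAB : A.diagram = B.diagram) : A.val φ = B.val φ := by
  obtain ⟨F, -, hv⟩ := StrC.exists_continuous_val h
  rw [hv, hv, hAB]

theorem StrC.val_toFormula (A : StrC L) (a : Atom L) : A.val a.toFormula = A.diagram a := by
  rcases a with ⟨s, t⟩ | ⟨k, R, ts⟩ <;>
    simp [StrC.val, Atom.toFormula, Str.val, StrC.diagram, Str.diagram, Str.termVal_relabel,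
      Function.comp_def]

/-- `A` satisfies all expressions in `S`. -/
def StrC.Satisfies (A : StrC L) (S : Set (OpenExpr L)) : Prop :=
  ∀ e ∈ S, (A.val e.φ : ℝ) < e.r

theorem exists_isOpen_of_finite {S : Set (OpenExpr L)} (hS : S.Finite) :
    ∃ U : Set (Atom L → I), IsOpen U ∧ ∀ A : StrC L, A.Satisfies S ↔ A.diagram ∈ U := by
  choose F hF hv using fun e : OpenExpr L => StrC.exists_continuous_val e.restricted.isQF
  refine ⟨⋂ e ∈ S, {x | (F e x : ℝ) < e.r}, hS.isOpen_biInter fun e _ =>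
    isOpen_lt (continuous_subtype_val.comp (hF e)) continuous_const, fun A => ?_⟩
  simp [StrC.Satisfies, hv]

/-- The expression `a < r`. -/
def Atom.ltExpr (a : Atom L) (r : ℝ) : OpenExpr L :=
  ⟨a.toFormula, .atomic a.toFormula_isAtomic, r⟩

/-- The expression `1 - a < r`. -/
def Atom.negLtExpr (a : Atom L) (r : ℝ) : OpenExpr L :=
  ⟨.conn negConn fun _ => a.toFormula, .neg fun _ => .atomic a.toFormula_isAtomic, r⟩

/-- Basic neighbourhoods restrict finitely many atomic values to intervals. The upper bounds are
expressions `a < r`, the lower bounds are expressions `1 - a < r`. -/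
theorem exists_finite_of_isOpen {V : Set (Atom L → I)} (hV : IsOpen V) {A : StrC L}
    (hA : A.diagram ∈ V) : ∃ S : Set (OpenExpr L), S.Finite ∧ A.Satisfies S ∧
      ∀ B : StrC L, B.Satisfies S → B.diagram ∈ V := by
  obtain ⟨J, U, hU, hsub⟩ := isOpen_pi_iff.1 hV _ hA
  have h1 : ∀ a ∈ J, ∃ ε > 0, Metric.ball (A.diagram a) ε ⊆ U a := fun a ha =>
    Metric.isOpen_iff.1 (hU a ha).1 _ (hU a ha).2
  choose! ε hε hball using h1
  have hneg : ∀ (B : StrC L) (a : Atom L),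
      (B.val (.conn negConn fun _ => a.toFormula) : ℝ) = 1 - B.diagram a := by
    intro B a
    rw [← B.val_toFormula]
    rfl
  refine ⟨⋃ a ∈ (J : Set (Atom L)), {a.ltExpr (A.diagram a + ε a),
    a.negLtExpr (1 - A.diagram a + ε a)}, J.finite_toSet.biUnion fun a _ => by simp, ?_, ?_⟩
  · intro e he
    simp only [mem_iUnion, mem_insert_iff, mem_singleton_iff] at he
    obtain ⟨a, ha, rfl | rfl⟩ := he
    · have := hε a ha
      simp only [Atom.ltExpr, A.val_toFormula]
      linarith
    · have := hε a ha
      simp only [Atom.negLtExpr, hneg]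
      linarith
  · intro B hB
    refine hsub fun a ha => hball a ha ?_
    have h1 := hB (a.ltExpr (A.diagram a + ε a)) (by
      simp only [mem_iUnion]; exact ⟨a, ha, by simp⟩)
    have h2 := hB (a.negLtExpr (1 - A.diagram a + ε a)) (by
      simp only [mem_iUnion]; exact ⟨a, ha, by simp⟩)
    simp only [Atom.ltExpr, B.val_toFormula] at h1
    simp only [Atom.negLtExpr, hneg] at h2
    rw [Metric.mem_ball, Subtype.dist_eq, Real.dist_eq, abs_lt]
    constructor <;> linarith

theorem Condition.exists_extension {T : Theory L} (p : Condition T) {V : Set (Atom L → I)}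
    (hV : IsOpen V) {A : StrC L} (hT : A.reduct.Models T) (hp : A.Satisfies p.exprs)
    (hA : A.diagram ∈ V) : ∃ q : Condition T, p.exprs ⊆ q.exprs ∧
      ∀ B : StrC L, B.Satisfies q.exprs → B.diagram ∈ V := by
  obtain ⟨S, hS, hAS, hB⟩ := exists_finite_of_isOpen hV hA
  refine ⟨⟨p.exprs ∪ S, p.finite.union hS, A, hT, ?_⟩, subset_union_left, fun B h => hB B ?_⟩
  · rintro e (he | he)
    · exact hp e he
    · exact hAS e he
  · exact fun e he => h e (Or.inr he)

/-! ### Embeddings and isomorphisms in terms of diagrams. -/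

namespace Embedding

theorem map_termVal {M N : Str L} (e : Embedding M N) {β : Type*} (v : β → M.carrier)
    (t : L.Term β) : N.termVal (e.toFun ∘ v) t = e.toFun (M.termVal v t) := by
  induction t with
  | var x => rfl
  | func f ts ih =>
    simp only [Str.termVal, e.map_fun]
    congr 1
    funext i
    exact ih i

theorem diagram_comp {M N : Str L} (e : Embedding M N) (v : ℕ → M.carrier) :
    N.diagram (e.toFun ∘ v) = M.diagram v := by
  funext a
  rcases a with ⟨s, t⟩ | ⟨k, R, ts⟩
  · simp only [Str.diagram, e.map_termVal, e.isometry.dist_eq]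
  · simp only [Str.diagram, e.map_termVal]
    exact e.map_rel R _

end Embedding

theorem Isomorphic.symm {M N : Str L} (h : Isomorphic M N) : Isomorphic N M := by
  obtain ⟨e, he⟩ := h
  have hl : ∀ x, e.toFun (Function.surjInv he x) = x := Function.surjInv_eq he
  have hc : ∀ {n : ℕ} (x : Fin n → N.carrier), e.toFun ∘ (Function.surjInv he ∘ x) = x :=
    fun x => funext fun i => hl _
  refine ⟨⟨Function.surjInv he, ?_, ?_, ?_⟩, fun x => ⟨e.toFun x, ?_⟩⟩
  · refine Isometry.of_dist_eq fun x y => ?_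
    rw [← e.isometry.dist_eq, hl, hl]
  · intro n f x
    apply e.isometry.injective
    rw [hl, e.map_fun, hc]
  · intro n R x
    rw [← e.map_rel, hc]
  · apply e.isometry.injective
    rw [hl]

theorem Isomorphic.trans {M N K : Str L} (h : Isomorphic M N) (h' : Isomorphic N K) :
    Isomorphic M K := by
  obtain ⟨e, he⟩ := h
  obtain ⟨f, hf⟩ := h'
  refine ⟨⟨f.toFun ∘ e.toFun, f.isometry.comp e.isometry, ?_, ?_⟩, hf.comp he⟩
  · intro n g x
    simp only [Function.comp_apply, e.map_fun, f.map_fun]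
    rfl
  · intro n R x
    rw [← e.map_rel, ← f.map_rel]
    rfl

theorem isoClass_eq_of_isomorphic {M N : Str L} (h : Isomorphic M N) : isoClass M = isoClass N :=
  Set.ext fun _ => ⟨fun hM => h.symm.trans hM, fun hN => h.trans hN⟩

/-- Structures generated by constants with the same atomic values are isomorphic. -/
theorem isomorphic_of_diagram_eq {M N : Str L} {a : ℕ → M.carrier} {b : ℕ → N.carrier}
    (h : M.diagram a = N.diagram b) (ha : DenseRange fun t : L.Term ℕ => M.termVal a t)
    (hb : DenseRange fun t : L.Term ℕ => N.termVal b t) : Isomorphic M N := by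
  -- Under the metric pulled back from `M`, both evaluation maps on closed terms are isometric, so
  -- the map between their ranges extends to the completion.
  let : PseudoMetricSpace (L.Term ℕ) := PseudoMetricSpace.induced (M.termVal a) inferInstance
  have hM : Isometry fun t : L.Term ℕ => M.termVal a t := Isometry.of_dist_eq fun s t => rfl
  have hN : Isometry fun t : L.Term ℕ => N.termVal b t := Isometry.of_dist_eq fun s t => by
    have := congrArg Subtype.val (congrFun h (.inl (s, t)))
    exact this.symm
  have hui := hM.isUniformInducing
  have hdi := hui.isDenseInducing ha
  set f := hdi.extend fun t : L.Term ℕ => N.termVal b t with hf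
  have hfc : UniformContinuous f := uniformContinuous_uniformly_extend hui ha hN.uniformContinuous
  have hft : ∀ t, f (M.termVal a t) = N.termVal b t := fun t =>
    uniformly_extend_of_ind hui ha hN.uniformContinuous t
  have hiso : Isometry f := by
    refine Isometry.of_dist_eq fun x y => ?_
    refine ha.induction_on₂ (p := fun x y => dist (f x) (f y) = dist x y) ?_ ?_ x y
    · exact isClosed_eq ((hfc.continuous.comp continuous_fst).dist
        (hfc.continuous.comp continuous_snd)) continuous_dist
    · intro s t
      rw [hft, hft]
      exact hN.dist_eq s t
  have hpi : ∀ n : ℕ, DenseRange fun ts : Fin n → L.Term ℕ => fun i => M.termVal a (ts i) :=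
    fun n => DenseRange.piMap fun _ => ha
  refine ⟨⟨f, hiso, ?_, ?_⟩, ?_⟩
  · intro n g x
    refine (hpi n).induction_on (p := fun x => f (M.funMap g x) = N.funMap g (f ∘ x)) x ?_ ?_
    · exact isClosed_eq (hfc.continuous.comp (M.continuous_funMap g))
        ((N.continuous_funMap g).comp (continuous_pi fun i =>
          hfc.continuous.comp (continuous_apply i)))
    · intro ts
      have h1 := hft (.func g ts)
      simp only [Str.termVal] at h1
      rw [h1]
      congr 1
      funext i
      exact (hft _).symm
  · intro n R x
    refine (hpi n).induction_on (p := fun x => N.relMap R (f ∘ x) = M.relMap R x) x ?_ ?_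
    · exact isClosed_eq ((N.uniformContinuous_relMap R).continuous.comp (continuous_pi fun i =>
          hfc.continuous.comp (continuous_apply i))) (M.uniformContinuous_relMap R).continuous
    · intro ts
      have h1 := congrFun h (.inr ⟨n, R, ts⟩)
      simp only [Str.diagram] at h1
      rw [h1]
      congr 1
      funext i
      exact hft _
  -- An isometric image of a complete space is closed, and this one contains the dense set of term
  -- values.
  · have hcl : IsClosed (range f) := hiso.isClosedEmbedding.isClosed_range
    rw [← range_eq_univ, ← hcl.closure_eq]
    refine (hb.mono ?_).closure_eq
    rintro _ ⟨t, rfl⟩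
    exact ⟨_, hft t⟩

end ContLogic

namespace ContLogic

/-! ### Structures with prescribed atomic values -/

open Topology Set

variable {L : Signature.{u}}

/-- A map that respects a modulus of continuity extends from a dense subspace. -/
theorem exists_extension_modulus {α α' β : Type*} [PseudoMetricSpace α] [MetricSpace α']
    [MetricSpace β] [CompleteSpace β] {i : α → α'} (hi : Isometry i) (hd : DenseRange i)
    (g : α → β) (m : ℝ → ℝ) (hm : ∀ ε, 0 < ε → 0 < m ε)
    (hg : ∀ ε, 0 < ε → ∀ x y, dist x y < m ε → dist (g x) (g y) ≤ ε) :
    ∃ g' : α' → β, (∀ a, g' (i a) = g a) ∧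
      ∀ ε, 0 < ε → ∀ x y, dist x y < m ε → dist (g' x) (g' y) ≤ ε := by
  have hu : UniformContinuous g := by
    refine Metric.uniformContinuous_iff.2 fun ε hε => ?_
    refine ⟨_, hm (ε / 2) (by positivity), fun {x y} h => ?_⟩
    linarith [hg (ε / 2) (by positivity) x y h]
  have hui := hi.isUniformInducing
  have hdi := hui.isDenseInducing hd
  have hc : UniformContinuous (hdi.extend g) := uniformContinuous_uniformly_extend hui hd hu
  have he : ∀ a, hdi.extend g (i a) = g a := fun a => uniformly_extend_of_ind hui hd hu a
  refine ⟨hdi.extend g, he, fun ε hε x y hxy => ?_⟩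
  -- The strict hypothesis is open, so pairs from the dense set that satisfy it accumulate at `(x,
  -- y)`; the non-strict conclusion is closed and passes to the limit.
  have hO : IsOpen {p : α' × α' | dist p.1 p.2 < m ε} := isOpen_lt continuous_dist continuous_const
  have hD : Dense (range (Prod.map i i)) := hd.prodMap hd
  have hmem := hD.open_subset_closure_inter hO (show (x, y) ∈ _ from hxy)
  refine closure_minimal (t := {p : α' × α' | dist (hdi.extend g p.1) (hdi.extend g p.2) ≤ ε})
    ?_ (isClosed_le ((hc.continuous.comp continuous_fst).dist
      (hc.continuous.comp continuous_snd)) continuous_const) hmem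
  rintro _ ⟨hlt, ⟨a, b⟩, rfl⟩
  simp only [mem_ofPred_eq, Prod.map_apply] at hlt ⊢
  rw [hi.dist_eq] at hlt
  rw [he, he]
  exact hg ε hε a b hlt

/-- The value of `dist s t` according to an assignment of values to atomic sentences. -/
def atomDist (x : Atom L → I) (s t : L.Term ℕ) : ℝ := x (.inl (s, t))

/-- The value of `R ts` according to an assignment of values to atomic sentences. -/
def atomRel (x : Atom L → I) {k : ℕ} (R : L.Relations k) (ts : Fin k → L.Term ℕ) : I :=
  x (.inr ⟨k, R, ts⟩)

theorem continuous_atomDist (s t : L.Term ℕ) :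
    Continuous fun x : Atom L → I => atomDist x s t :=
  continuous_subtype_val.comp (continuous_apply _)

theorem continuous_atomRel {k : ℕ} (R : L.Relations k) (ts : Fin k → L.Term ℕ) :
    Continuous fun x : Atom L → I => atomRel x R ts :=
  continuous_apply _

/-- The closed conditions that make an assignment of values to atomic sentences a prestructure on
the set of closed terms. -/
structure IsPrestructure (x : Atom L → I) : Prop where
  dist_self : ∀ s, atomDist x s s = 0
  dist_comm : ∀ s t, atomDist x s t = atomDist x t s
  dist_triangle : ∀ s t r, atomDist x s r ≤ atomDist x s t + atomDist x t r
  fun_modulus : ∀ (n : ℕ) (f : L.Functions n) (ε : ℝ), 0 < ε → ∀ ss ts : Fin n → L.Term ℕ,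
    (∃ i, L.funModulus f ε ≤ atomDist x (ss i) (ts i)) ∨ atomDist x (.func f ss) (.func f ts) ≤ ε
  rel_modulus : ∀ (n : ℕ) (R : L.Relations n) (ε : ℝ), 0 < ε → ∀ ss ts : Fin n → L.Term ℕ,
    (∃ i, L.relModulus R ε ≤ atomDist x (ss i) (ts i)) ∨ dist (atomRel x R ss) (atomRel x R ts) ≤ ε

/-- The modulus axioms are phrased as disjunctions so that the implication from a strict bound
becomes a finite union of closed sets. -/
theorem isClosed_isPrestructure : IsClosed {x : Atom L → I | IsPrestructure x} := by
  have : {x : Atom L → I | IsPrestructure x} =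
      {x | ∀ s, atomDist x s s = 0} ∩ {x | ∀ s t, atomDist x s t = atomDist x t s} ∩
      {x | ∀ s t r, atomDist x s r ≤ atomDist x s t + atomDist x t r} ∩
      {x | ∀ (n : ℕ) (f : L.Functions n) (ε : ℝ), 0 < ε → ∀ ss ts : Fin n → L.Term ℕ,
        (∃ i, L.funModulus f ε ≤ atomDist x (ss i) (ts i)) ∨
          atomDist x (.func f ss) (.func f ts) ≤ ε} ∩
      {x | ∀ (n : ℕ) (R : L.Relations n) (ε : ℝ), 0 < ε → ∀ ss ts : Fin n → L.Term ℕ,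
        (∃ i, L.relModulus R ε ≤ atomDist x (ss i) (ts i)) ∨
          dist (atomRel x R ss) (atomRel x R ts) ≤ ε} := by
    ext x
    exact ⟨fun h => ⟨⟨⟨⟨h.1, h.2⟩, h.3⟩, h.4⟩, h.5⟩, fun h => ⟨h.1.1.1.1, h.1.1.1.2, h.1.1.2, h.1.2,
      h.2⟩⟩
  rw [this]
  have hd := fun s t => continuous_atomDist (L := L) s t
  refine (((IsClosed.inter ?_ ?_).inter ?_).inter ?_).inter ?_
  · simp only [ofPred_forall]
    exact isClosed_iInter fun s => isClosed_eq (hd _ _) continuous_const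
  · simp only [ofPred_forall]
    exact isClosed_iInter fun s => isClosed_iInter fun t => isClosed_eq (hd _ _) (hd _ _)
  · simp only [ofPred_forall]
    exact isClosed_iInter fun s => isClosed_iInter fun t => isClosed_iInter fun r =>
      isClosed_le (hd _ _) ((hd _ _).add (hd _ _))
  · simp only [ofPred_forall, ofPred_or, ofPred_exists]
    refine isClosed_iInter fun n => isClosed_iInter fun f => isClosed_iInter fun ε =>
      isClosed_iInter fun _ => isClosed_iInter fun ss => isClosed_iInter fun ts =>
      IsClosed.union (isClosed_iUnion_of_finite fun i => isClosed_le continuous_const (hd _ _)) ?_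
    exact isClosed_le (hd _ _) continuous_const
  · simp only [ofPred_forall, ofPred_or, ofPred_exists]
    refine isClosed_iInter fun n => isClosed_iInter fun f => isClosed_iInter fun ε =>
      isClosed_iInter fun _ => isClosed_iInter fun ss => isClosed_iInter fun ts =>
      IsClosed.union (isClosed_iUnion_of_finite fun i => isClosed_le continuous_const (hd _ _)) ?_
    exact isClosed_le ((continuous_atomRel _ _).dist (continuous_atomRel _ _)) continuous_const

theorem isPrestructure_diagram (M : Str L) (v : ℕ → M.carrier) : IsPrestructure (M.diagram v) where
  dist_self s := dist_self _
  dist_comm s t := dist_comm _ _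
  dist_triangle s t r := dist_triangle _ _ _
  fun_modulus n f ε hε ss ts := by
    by_contra! h
    refine h.2.not_ge (M.funMap_modulus f ε hε _ _ ?_)
    exact (dist_pi_lt_iff (L.funModulus_pos f ε hε)).2 h.1
  rel_modulus n R ε hε ss ts := by
    by_contra! h
    refine h.2.not_ge (M.relMap_modulus R ε hε _ _ ?_)
    exact (dist_pi_lt_iff (L.relModulus_pos R ε hε)).2 h.1

/-- The completion of a prestructure on the set of closed terms. -/
theorem IsPrestructure.exists_strC {x : Atom L → I} (hx : IsPrestructure x) :
    ∃ A : StrC L, A.diagram = x ∧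
      DenseRange fun t : L.Term ℕ => A.reduct.termVal A.const t := by
  let : PseudoMetricSpace (L.Term ℕ) :=
    { dist := atomDist x
      dist_self := hx.dist_self
      dist_comm := hx.dist_comm
      dist_triangle := hx.dist_triangle }
  have hdist : ∀ s t : L.Term ℕ, dist s t = atomDist x s t := fun s t => rfl
  let Y := UniformSpace.Completion (L.Term ℕ)
  let c : L.Term ℕ → Y := fun t => (t : UniformSpace.Completion (L.Term ℕ))
  have hc : Isometry c := UniformSpace.Completion.coe_isometry
  have hcd : DenseRange c := UniformSpace.Completion.denseRange_coe
  have hpi : ∀ n : ℕ, Isometry fun (ts : Fin n → L.Term ℕ) i => c (ts i) := fun n =>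
    Isometry.of_dist_eq fun s t => by simp only [dist_pi_def, nndist_dist, hc.dist_eq]
  have hpid : ∀ n : ℕ, DenseRange fun (ts : Fin n → L.Term ℕ) i => c (ts i) := fun n =>
    DenseRange.piMap fun _ => hcd
  have hF : ∀ (n : ℕ) (f : L.Functions n), ∃ g : (Fin n → Y) → Y,
      (∀ ts : Fin n → L.Term ℕ, g (fun i => c (ts i)) = c (.func f ts)) ∧
      ∀ ε, 0 < ε → ∀ x y, dist x y < L.funModulus f ε → dist (g x) (g y) ≤ ε := by
    intro n f
    refine exists_extension_modulus (hpi n) (hpid n) (fun ts => c (.func f ts)) _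
      (L.funModulus_pos f) fun ε hε ss ts h => ?_
    rw [hc.dist_eq]
    rcases hx.fun_modulus n f ε hε ss ts with ⟨i, hi⟩ | h'
    · exact absurd ((dist_pi_lt_iff (L.funModulus_pos f ε hε)).1 h i) hi.not_gt
    · exact h'
  have hR : ∀ (n : ℕ) (R : L.Relations n), ∃ g : (Fin n → Y) → I,
      (∀ ts : Fin n → L.Term ℕ, g (fun i => c (ts i)) = atomRel x R ts) ∧
      ∀ ε, 0 < ε → ∀ x y, dist x y < L.relModulus R ε → dist (g x) (g y) ≤ ε := by
    intro n R
    refine exists_extension_modulus (hpi n) (hpid n) (fun ts => atomRel x R ts) _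
      (L.relModulus_pos R) fun ε hε ss ts h => ?_
    rcases hx.rel_modulus n R ε hε ss ts with ⟨i, hi⟩ | h'
    · exact absurd ((dist_pi_lt_iff (L.relModulus_pos R ε hε)).1 h i) hi.not_gt
    · exact h'
  choose F hF1 hF2 using hF
  choose R hR1 hR2 using hR
  have hne : Nonempty Y := ⟨c (.var 0)⟩
  let M : Str L :=
    { carrier := Y
      dist_le_one := fun y z => by
        refine hcd.induction_on₂ (p := fun y z => dist y z ≤ 1)
          (isClosed_le continuous_dist continuous_const) (fun s t => ?_) y z
        rw [hc.dist_eq, hdist]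
        exact (x _).2.2
      funMap := fun {n} f => F n f
      relMap := fun {n} r => R n r
      funMap_modulus := fun {n} f => hF2 n f
      relMap_modulus := fun {n} r => hR2 n r }
  have hval : ∀ t : L.Term ℕ, M.termVal (fun i => c (.var i)) t = c t := by
    intro t
    induction t with
    | var i => rfl
    | func f ts ih =>
      simp only [Str.termVal, ih]
      exact hF1 _ f ts
  refine ⟨⟨M, fun i => c (.var i)⟩, ?_, ?_⟩
  · funext a
    rcases a with ⟨s, t⟩ | ⟨k, r, ts⟩
    · apply Subtype.ext
      simp only [StrC.diagram, Str.diagram, hval]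
      exact hc.dist_eq s t
    · simp only [StrC.diagram, Str.diagram, hval]
      exact hR1 k r ts
  · simp only [hval]
    exact hcd

/-- The diagrams of the models of `T` with all interpretations of the constants. -/
def modelDiagrams (T : Theory L) : Set (Atom L → I) :=
  {x | ∃ M : Str L, M.Models T ∧ ∃ v : ℕ → M.carrier, M.diagram v = x}

/-- Limits of diagrams of models are still diagrams of structures, though not necessarily of models
of `T`. -/
theorem exists_strC_of_mem_closure {T : Theory L} {x : Atom L → I}
    (hx : x ∈ closure (modelDiagrams T)) : ∃ A : StrC L, A.diagram = x ∧
      DenseRange fun t : L.Term ℕ => A.reduct.termVal A.const t := by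
  refine IsPrestructure.exists_strC (closure_minimal ?_ isClosed_isPrestructure hx)
  rintro _ ⟨M, -, v, rfl⟩
  exact isPrestructure_diagram M v

end ContLogic

namespace ContLogic

/-! ### Diagrams deciding existential statements -/

open Topology Set

variable {L : Signature.{u}}

/-- The sequence that starts with the first `K` entries of `a` and continues with `b`. -/
def splice {Y : Type*} (K : ℕ) (a b : ℕ → Y) : ℕ → Y := fun i => if i < K then a i else b (i - K)

theorem splice_of_lt {Y : Type*} {K i : ℕ} (a b : ℕ → Y) (hi : i < K) : splice K a b i = a i :=
  if_pos hi

theorem splice_comp_add {Y : Type*} (K : ℕ) (a b : ℕ → Y) :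
    splice K a b ∘ (fun i => K + i) = b := by
  funext i
  simp [splice]

/-- `W` is dense relative to the diagrams of models of `T`. -/
def DenseInModels (T : Theory L) (W : Set (Atom L → I)) : Prop :=
  ∀ U : Set (Atom L → I), IsOpen U → (U ∩ modelDiagrams T).Nonempty →
    (U ∩ W ∩ modelDiagrams T).Nonempty

/-- No model of `T` has a tuple with diagram in `P` and a tuple with diagram in `U` whose entries
are related by `l` up to `r`. -/
def Refutes (T : Theory L) (U : Set (Atom L → I)) (l : Finset (ℕ × ℕ)) (r : ℝ)
    (P : Set (Atom L → I)) : Prop :=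
  ∀ N : Str L, N.Models T → ∀ v₁ v₂ : ℕ → N.carrier, N.diagram v₁ ∈ P → N.diagram v₂ ∈ U →
    ¬ ∀ z ∈ l, dist (v₂ z.1) (v₁ z.2) < r

/-- The constants realize `U` near the parameters prescribed by `l`, or an open part of the diagram
refutes this in all models of `T`. -/
def decidingSet (T : Theory L) (U : Set (Atom L → I)) (l : Finset (ℕ × ℕ)) (r : ℝ) :
    Set (Atom L → I) :=
  {x | ∃ j : ℕ → ℕ, x ∘ Atom.relabel j ∈ U ∧ ∀ z ∈ l, atomDist x (.var (j z.1)) (.var z.2) < r} ∪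
    ⋃₀ {P | IsOpen P ∧ Refutes T U l r P}

theorem isOpen_decidingSet (T : Theory L) {U : Set (Atom L → I)} (hU : IsOpen U)
    (l : Finset (ℕ × ℕ)) (r : ℝ) : IsOpen (decidingSet T U l r) := by
  refine IsOpen.union ?_ (isOpen_sUnion fun P hP => hP.1)
  rw [ofPred_exists]
  refine isOpen_iUnion fun j => IsOpen.inter (hU.preimage (continuous_comp_relabel j)) ?_
  have : {x : Atom L → I | ∀ z ∈ l, atomDist x (.var (j z.1)) (.var z.2) < r} =
      ⋂ z ∈ l, {x | atomDist x (.var (j z.1)) (.var z.2) < r} := by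
    ext x; simp
  refine (?_ : IsOpen {x : Atom L → I | ∀ z ∈ l, atomDist x (.var (j z.1)) (.var z.2) < r})
  rw [this]
  exact isOpen_biInter_finset fun z _ => isOpen_lt (continuous_atomDist _ _) continuous_const

/-- Either the given open set is itself refuting, or a counterexample to refutation supplies a
realization. The latter is put behind a long initial segment of the parameters, which leaves the
diagram in the open set. -/
theorem denseInModels_decidingSet (T : Theory L) (U : Set (Atom L → I))
    (l : Finset (ℕ × ℕ)) (r : ℝ) : DenseInModels T (decidingSet T U l r) := by
  rintro O hO ⟨x, hxO, hxT⟩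
  by_cases hr : Refutes T U l r O
  · exact ⟨x, ⟨hxO, .inr ⟨O, ⟨hO, hr⟩, hxO⟩⟩, hxT⟩
  · unfold Refutes at hr
    push Not at hr
    obtain ⟨N, hN, v₁, v₂, h₁, h₂, hl⟩ := hr
    obtain ⟨K₀, hK₀⟩ := exists_forall_lt_mem_of_isOpen (hO.preimage N.continuous_diagram) h₁
    -- The initial segment must keep the diagram in `O` and contain all parameters named in `l`.
    set K := max K₀ (l.sup Prod.snd + 1) with hK
    set v : ℕ → N.carrier := splice K v₁ v₂ with hv
    have hvj : v ∘ (fun i => K + i) = v₂ := splice_comp_add K v₁ v₂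
    refine ⟨N.diagram v, ⟨hK₀ v fun i hi => splice_of_lt _ _ (by omega), .inl ⟨fun i => K + i, ?_, ?_⟩⟩,
      N, hN, v, rfl⟩
    · rw [← N.diagram_comp, hvj]
      exact h₂
    · intro z hz
      have h3 : z.2 ≤ l.sup Prod.snd := Finset.le_sup (f := Prod.snd) hz
      have h4 : v z.2 = v₁ z.2 := splice_of_lt _ _ (by omega)
      have h5 : v (K + z.1) = v₂ z.1 := congrFun hvj z.1
      change dist (v (K + z.1)) (v z.2) < r
      rw [h4, h5]
      exact hl z hz

/-- Witnesses for an existential formula satisfy a continuous condition on atomic values. -/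
theorem Formula.IsExistential.exists_continuous {n : ℕ} {ψ : Formula L Empty n}
    (h : ψ.IsExistential) : ∃ F : (Atom L → I) → I, Continuous F ∧
      (∀ (N : Str L) (v : ℕ → N.carrier),
        N.val Empty.elim ψ (fun i => v i) ≤ F (N.diagram v)) ∧
      ∀ (N : Str L) (x : Fin n → N.carrier) (δ : I), N.val Empty.elim ψ x < δ →
        ∃ v : ℕ → N.carrier, (∀ i : Fin n, v i = x i) ∧ F (N.diagram v) < δ := by
  induction h with
  | @qf n φ h =>
    obtain ⟨F, hF, hv⟩ := h.exists_continuous (Sum.elim Empty.elim fun i => (i : ℕ))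
    have hv' : ∀ (N : Str L) (v : ℕ → N.carrier),
        N.val Empty.elim φ (fun i => v i) = F (N.diagram v) := by
      intro N v
      rw [← hv]
      congr
      exact Subsingleton.elim _ _
    refine ⟨F, hF, fun N v => (hv' N v).le, fun N x δ hx => ?_⟩
    let v : ℕ → N.carrier := fun i => if hi : i < n then x ⟨i, hi⟩ else Classical.arbitrary _
    have hvx : ∀ i : Fin n, v i = x i := fun i => by simp [v]
    refine ⟨v, hvx, ?_⟩
    rw [← hv', funext hvx]
    exact hx
  | @inf n φ _ ih =>
    obtain ⟨F, hF, h1, h2⟩ := ih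
    refine ⟨F, hF, fun N v => ?_, fun N x δ hx => ?_⟩
    -- Entry `n` of the sequence serves as the witness for the variable bound by `inf`.
    · refine (iInf_le _ (v n)).trans ((le_of_eq ?_).trans (h1 N v))
      congr 1
      funext i
      refine Fin.lastCases ?_ (fun i => ?_) i <;> simp
    · obtain ⟨a, ha⟩ := iInf_lt_iff.1 hx
      obtain ⟨v, hv, hvF⟩ := h2 N _ δ ha
      refine ⟨v, fun i => ?_, hvF⟩
      have := hv i.castSucc
      rwa [Fin.snoc_castSucc] at this

/-- A countable family of open sets that separates compact sets from closed sets. -/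
def basicOpens (L : Signature.{u}) [Countable (Atom L)] : Set (Set (Atom L → I)) :=
  sUnion '' {s | s.Finite ∧ s ⊆ TopologicalSpace.countableBasis (Atom L → I)}

variable [Countable (Atom L)]

theorem countable_basicOpens : (basicOpens L).Countable :=
  (countable_ofPred_finite_subset (TopologicalSpace.countable_countableBasis _)).image _

theorem isOpen_of_mem_basicOpens {U : Set (Atom L → I)} (hU : U ∈ basicOpens L) : IsOpen U := by
  obtain ⟨s, ⟨-, hs⟩, rfl⟩ := hU
  exact isOpen_sUnion fun V hV => TopologicalSpace.isOpen_of_mem_countableBasis (hs hV)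

theorem exists_basicOpens_between {K U : Set (Atom L → I)} (hK : IsCompact K) (hU : IsOpen U)
    (hKU : K ⊆ U) : ∃ V ∈ basicOpens L, K ⊆ V ∧ V ⊆ U := by
  have hB := TopologicalSpace.isBasis_countableBasis (Atom L → I)
  let S := {V | V ∈ TopologicalSpace.countableBasis (Atom L → I) ∧ V ⊆ U}
  have hcov : K ⊆ ⋃ V ∈ S, id V := by
    intro x hx
    obtain ⟨V, hV, hxV, hVU⟩ := hB.exists_subset_of_mem_open (hKU hx) hU
    simp only [mem_iUnion]
    exact ⟨V, ⟨hV, hVU⟩, hxV⟩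
  obtain ⟨s, hsS, hs, hKs⟩ := hK.elim_finite_subcover_image (fun V hV => hB.isOpen hV.1) hcov
  refine ⟨⋃₀ s, ⟨s, ⟨hs, fun V hV => (hsS hV).1⟩, rfl⟩, ?_, sUnion_subset fun V hV => (hsS hV).2⟩
  rwa [sUnion_eq_biUnion]

/-- The diagram of `A` decides all existential statements about the constants. -/
structure IsDeciding (T : Theory L) (A : StrC L) : Prop where
  mem_closure : A.diagram ∈ closure (modelDiagrams T)
  mem_decidingSet : ∀ U ∈ basicOpens L, ∀ (l : Finset (ℕ × ℕ)) (r : ℚ),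
    A.diagram ∈ decidingSet T U l r
  dense : DenseRange fun t : L.Term ℕ => A.reduct.termVal A.const t

/-! ### Deciding structures are models. -/

namespace IsDeciding

variable {T : Theory L} {A : StrC L}

/-- Since `H` rules out every refuting neighbourhood, the other half of the deciding set must hold.
The gaps between `K` and `U` and between `r` and `r'` leave room for one of the countably many sets
and rationals that are decided. -/
theorem exists_realization (hA : IsDeciding T A) {K U : Set (Atom L → I)} (hK : IsCompact K)
    (hU : IsOpen U) (hKU : K ⊆ U) (l : Finset (ℕ × ℕ)) {r r' : ℝ} (hr : r < r')
    (H : ∀ P, IsOpen P → A.diagram ∈ P → ∃ N : Str L, N.Models T ∧ ∃ v₁ v₂ : ℕ → N.carrier,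
      N.diagram v₁ ∈ P ∧ N.diagram v₂ ∈ K ∧ ∀ z ∈ l, dist (v₂ z.1) (v₁ z.2) < r) :
    ∃ j : ℕ → ℕ, A.reduct.diagram (A.const ∘ j) ∈ U ∧
      ∀ z ∈ l, dist (A.const (j z.1)) (A.const z.2) < r' := by
  obtain ⟨V, hV, hKV, hVU⟩ := exists_basicOpens_between hK hU hKU
  obtain ⟨q, hq, hq'⟩ := exists_rat_btwn hr
  rcases hA.mem_decidingSet V hV l q with ⟨j, hj, hl⟩ | ⟨P, ⟨hP, hR⟩, hAP⟩
  · refine ⟨j, hVU ?_, fun z hz => (hl z hz).trans hq'⟩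
    rw [A.reduct.diagram_comp]
    exact hj
  · obtain ⟨N, hN, v₁, v₂, h₁, h₂, hl⟩ := H P hP hAP
    exact absurd (fun z hz => (hl z hz).trans hq) (hR N hN v₁ v₂ h₁ (hKV h₂))

theorem exists_model (hA : IsDeciding T A) {P : Set (Atom L → I)} (hP : IsOpen P)
    (hAP : A.diagram ∈ P) : ∃ N : Str L, N.Models T ∧ ∃ v : ℕ → N.carrier, N.diagram v ∈ P := by
  obtain ⟨_, h, N, hN, v, rfl⟩ := mem_closure_iff.1 hA.mem_closure P hP hAP
  exact ⟨N, hN, v, h⟩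

/-- The statement that some element equals the value of a term is true in every model, so it is
approximately realized by constants. Continuity of the term absorbs the error in its arguments. -/
theorem denseRange_const (hA : IsDeciding T A) : DenseRange A.const := by
  rw [DenseRange, ← dense_closure]
  refine hA.dense.mono ?_
  rintro _ ⟨t, rfl⟩
  refine Metric.mem_closure_range_iff.2 fun ε hε => ?_
  have hcont := (A.reduct.uniformContinuous_termVal t).continuous
  obtain ⟨J, O, hO, hsub⟩ := isOpen_pi_iff.1 (Metric.isOpen_ball.preimage hcont) A.const
    (Metric.mem_ball_self (half_pos hε))
  have h1 : ∀ i ∈ J, ∃ η > 0, Metric.ball (A.const i) η ⊆ O i := fun i hi =>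
    Metric.isOpen_iff.1 (hO i hi).1 _ (hO i hi).2
  choose! η hη hball using h1
  obtain ⟨η₀, hη₀, hle⟩ : ∃ η₀ > 0, ∀ i ∈ J, η₀ ≤ η i := by
    rcases J.eq_empty_or_nonempty with rfl | hJ
    · exact ⟨1, one_pos, by simp⟩
    · obtain ⟨i, hi, hmin⟩ := J.exists_min_image η hJ
      exact ⟨η i, hη i hi, hmin⟩
  -- Entry `0` is reserved for the value of `t`, and its arguments are shifted by one.
  have hc := continuous_atomDist (L := L) (t.relabel Nat.succ) (.var 0)
  obtain ⟨j, hj, hl⟩ := hA.exists_realization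
    (K := {x | atomDist x (t.relabel Nat.succ) (.var 0) ≤ 0})
    (U := {x | atomDist x (t.relabel Nat.succ) (.var 0) < ε / 2})
    (isClosed_le hc continuous_const).isCompact (isOpen_lt hc continuous_const)
    (fun x hx => lt_of_le_of_lt hx (half_pos hε)) (J.image fun i => (i + 1, i)) (half_lt_self hη₀)
    (fun P hP hAP => by
      obtain ⟨N, hN, v, hv⟩ := hA.exists_model hP hAP
      refine ⟨N, hN, v, fun i => Nat.casesOn i (N.termVal v t) v, hv, ?_, ?_⟩
      · change dist (N.termVal _ (t.relabel Nat.succ)) (N.termVal v t) ≤ 0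
        rw [N.termVal_relabel]
        exact (dist_self (N.termVal v t)).le
      · intro z hz
        obtain ⟨i, -, rfl⟩ := Finset.mem_image.1 hz
        simpa using hη₀)
  refine ⟨j 0, ?_⟩
  have h2 : A.const ∘ j ∘ Nat.succ ∈ (J : Set ℕ).pi O := fun i hi => hball i hi (by
    have := hl (i + 1, i) (Finset.mem_image.2 ⟨i, hi, rfl⟩)
    exact lt_of_lt_of_le this (hle i hi))
  have h3 : dist (A.reduct.termVal (A.const ∘ j ∘ Nat.succ) t) (A.reduct.termVal A.const t)
      < ε / 2 := hsub h2
  have h4 : dist (A.reduct.termVal (A.const ∘ j) (t.relabel Nat.succ)) (A.const (j 0)) < ε / 2 := hj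
  rw [A.reduct.termVal_relabel] at h4
  have h5 := dist_triangle_left (A.reduct.termVal A.const t) (A.const (j 0))
    (A.reduct.termVal (A.const ∘ j ∘ Nat.succ) t)
  have h6 : dist (A.reduct.termVal (A.const ∘ j ∘ Nat.succ) t) (A.const (j 0)) < ε / 2 := h4
  linarith

/-- If `ψ` exceeded `δ` at `x`, it would do so on a ball. Models near `A` provide witnesses for
values below `δ`, and these are realized in `A` by constants whose first `n` entries lie in that
ball. -/
theorem val_eq_zero_of_isExistential (hA : IsDeciding T A) {n : ℕ} {ψ : Formula L Empty n}
    (hψ : ψ.IsExistential)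
    (h : ∀ N : Str L, N.Models T → ∀ x : Fin n → N.carrier, N.val Empty.elim ψ x = 0)
    (x : Fin n → A.reduct.carrier) : A.reduct.val Empty.elim ψ x = 0 := by
  obtain ⟨F, hF, hle, hex⟩ := hψ.exists_continuous
  by_contra hne
  have hpos : 0 < A.reduct.val Empty.elim ψ x := unitInterval.pos_iff_ne_zero.2 hne
  obtain ⟨δ, hδ0, hδ⟩ := exists_between hpos
  obtain ⟨δ', hδ'0, hδ'⟩ := exists_between hδ0
  have hcont := (A.reduct.uniformContinuous_val_of_isExistential Empty.elim hψ).continuous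
  obtain ⟨η, hη, hball⟩ := Metric.isOpen_iff.1 (isOpen_lt continuous_const hcont) x hδ
  choose g hg using fun i => hA.denseRange_const.exists_dist_lt (x i) (half_pos hη)
  obtain ⟨j, hj, hl⟩ := hA.exists_realization (K := {y | F y ≤ δ'}) (U := {y | F y < δ})
    (isClosed_le hF continuous_const).isCompact (isOpen_lt hF continuous_const)
    (fun y hy => lt_of_le_of_lt hy hδ') (Finset.univ.image fun i : Fin n => ((i : ℕ), g i))
    (half_lt_self (half_pos hη)) (fun P hP hAP => by
      obtain ⟨N, hN, v, hv⟩ := hA.exists_model hP hAP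
      obtain ⟨v₂, hv₂, hlt⟩ := hex N (fun i => v (g i)) δ' (by rw [h N hN]; exact hδ'0)
      refine ⟨N, hN, v, v₂, hv, hlt.le, fun z hz => ?_⟩
      obtain ⟨i, -, rfl⟩ := Finset.mem_image.1 hz
      rw [hv₂, dist_self]
      positivity)
  have h1 : (fun i : Fin n => A.const (j i)) ∈ Metric.ball x η := by
    rw [Metric.mem_ball, dist_pi_lt_iff hη]
    intro i
    have h2 := hl (i, g i) (Finset.mem_image.2 ⟨i, Finset.mem_univ _, rfl⟩)
    have h3 := hg i
    have h4 := dist_triangle (A.const (j i)) (A.const (g i)) (x i)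
    rw [dist_comm] at h3
    simp only at h2
    linarith
  exact (hball h1).not_ge ((hle A.reduct (A.const ∘ j)).trans hj.le)

theorem val_eq_zero_of_isForallExists (hA : IsDeciding T A) {n : ℕ} {ψ : Formula L Empty n}
    (hψ : ψ.IsForallExists)
    (h : ∀ N : Str L, N.Models T → ∀ x : Fin n → N.carrier, N.val Empty.elim ψ x = 0)
    (x : Fin n → A.reduct.carrier) : A.reduct.val Empty.elim ψ x = 0 := by
  induction hψ with
  | ex hψ => exact hA.val_eq_zero_of_isExistential hψ h x
  | @sup n φ _ ih =>
    refine le_antisymm (iSup_le fun a => (ih (fun N hN y => ?_) _).le) bot_le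
    have h1 := h N hN (Fin.init y)
    have h2 : N.val Empty.elim φ (Fin.snoc (Fin.init y) (y (Fin.last n))) ≤
      N.val Empty.elim (.sup φ) (Fin.init y) :=
        le_iSup (fun a => N.val Empty.elim φ (Fin.snoc (Fin.init y) a)) (y (Fin.last n))
    rw [Fin.snoc_init_self, h1] at h2
    exact le_antisymm h2 bot_le

theorem models (hA : IsDeciding T A) (hT : T.ForallExistsAxiomatizable) : A.reduct.Models T := by
  obtain ⟨T', hT', hiff⟩ := hT
  refine (hiff _).2 fun φ hφ => hA.val_eq_zero_of_isForallExists (hT' φ hφ) (fun N hN x => ?_) _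
  rw [Subsingleton.elim x Fin.elim0]
  exact (hiff N).1 hN φ hφ

end IsDeciding

end ContLogic

namespace ContLogic

/-! ### Generic structures and back-and-forth -/

open Topology Set Filter

variable {L : Signature.{u}}

/-- Any two open parts of `U` that are consistent with `T` have realizations in a common model
whose first `n` entries are at distance at most `ε`. -/
def IsGood (T : Theory L) (U : Set (Atom L → I)) (n : ℕ) (ε : ℝ) : Prop :=
  ∀ U₁ U₂ : Set (Atom L → I), IsOpen U₁ → IsOpen U₂ → U₁ ⊆ U → U₂ ⊆ U →
    (U₁ ∩ modelDiagrams T).Nonempty → (U₂ ∩ modelDiagrams T).Nonempty →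
    ∃ M : Str L, M.Models T ∧ ∃ v₁ v₂ : ℕ → M.carrier, M.diagram v₁ ∈ U₁ ∧ M.diagram v₂ ∈ U₂ ∧
      ∀ i < n, dist (v₁ i) (v₂ i) ≤ ε

theorem IsGood.mono {T : Theory L} {U V : Set (Atom L → I)} {n : ℕ} {ε δ : ℝ}
    (h : IsGood T U n ε) (hVU : V ⊆ U) (hεδ : ε ≤ δ) : IsGood T V n δ := by
  intro U₁ U₂ h₁ h₂ hs₁ hs₂ hn₁ hn₂
  obtain ⟨M, hM, v₁, v₂, hv₁, hv₂, hd⟩ := h U₁ U₂ h₁ h₂ (hs₁.trans hVU) (hs₂.trans hVU) hn₁ hn₂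
  exact ⟨M, hM, v₁, v₂, hv₁, hv₂, fun i hi => (hd i hi).trans hεδ⟩

/-- For empty tuples goodness is joint embedding; this starts the back-and-forth. -/
theorem isGood_univ_zero {T : Theory L} (hJEP : T.JEP) (ε : ℝ) : IsGood T univ 0 ε := by
  rintro U₁ U₂ - - - - ⟨_, h₁, M₁, hM₁, v₁, rfl⟩ ⟨_, h₂, M₂, hM₂, v₂, rfl⟩
  obtain ⟨K, hK, ⟨e₁⟩, ⟨e₂⟩⟩ := hJEP M₁ M₂ hM₁ hM₂
  refine ⟨K, hK, e₁.toFun ∘ v₁, e₂.toFun ∘ v₂, ?_, ?_, by simp⟩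
  · rwa [e₁.diagram_comp]
  · rwa [e₂.diagram_comp]

/-- The assignments of values that put the `i`-th and the `f i`-th constant at distance less than
`δ` for all `i < n`. -/
def closeSet (L : Signature.{u}) (n : ℕ) (f : ℕ → ℕ) (δ : ℝ) : Set (Atom L → I) :=
  {x | ∀ i < n, atomDist x (.var i) (.var (f i)) < δ}

theorem isOpen_closeSet (n : ℕ) (f : ℕ → ℕ) (δ : ℝ) : IsOpen (closeSet L n f δ) := by
  have : closeSet L n f δ = ⋂ i ∈ Finset.range n, {x | atomDist x (.var i) (.var (f i)) < δ} := by
    ext x; simp [closeSet]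
  rw [this]
  exact isOpen_biInter_finset fun i _ => isOpen_lt (continuous_atomDist _ _) continuous_const

theorem diagram_mem_closeSet {M : Str L} {v : ℕ → M.carrier} {n : ℕ} {f : ℕ → ℕ} {δ : ℝ} :
    M.diagram v ∈ closeSet L n f δ ↔ ∀ i < n, dist (v i) (v (f i)) < δ := Iff.rfl

variable [Countable (Atom L)] {T : Theory L}

/-- A tuple near a tuple with good diagram can be transferred to any model with a deciding
enumeration. -/
theorem IsDeciding.exists_transfer {B : StrC L} (hB : IsDeciding T B) (hBT : B.reduct.Models T)
    {U : Set (Atom L → I)} (hU : IsOpen U) {n : ℕ} {ε : ℝ} (hε : 0 < ε) (hgood : IsGood T U n ε)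
    {M : Str L} (hM : M.Models T) {v : ℕ → M.carrier} (hv : M.diagram v ∈ U)
    {w : ℕ → B.reduct.carrier} (hw : B.reduct.diagram w ∈ U) {U' : Set (Atom L → I)}
    (hU' : IsOpen U') {v' : ℕ → M.carrier} (hv' : M.diagram v' ∈ U') (h : ℕ → ℕ)
    (hh : ∀ i < n, dist (v' (h i)) (v i) < ε) :
    ∃ w' : ℕ → B.reduct.carrier, B.reduct.diagram w' ∈ U' ∧ ∀ i < n, dist (w' (h i)) (w i) < 5 * ε := by
  have hdense : DenseRange fun (g : ℕ → ℕ) i => B.const (g i) :=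
    DenseRange.piMap fun _ => hB.denseRange_const
  have hO : IsOpen ({w' | B.reduct.diagram w' ∈ U} ∩
      ⋂ i ∈ Finset.range n, {w' : ℕ → B.reduct.carrier | dist (w' i) (w i) < ε}) :=
    (hU.preimage B.reduct.continuous_diagram).inter (isOpen_biInter_finset fun i _ =>
      isOpen_lt ((continuous_apply i).dist continuous_const) continuous_const)
  -- Deciding sets only speak about constants, so `w` is first replaced by constants `ε`-close to it
  -- on the first `n` entries.
  obtain ⟨g, hgU, hg⟩ := hdense.exists_mem_open hO ⟨w, hw, by simp [hε]⟩
  simp only [mem_iInter, Finset.mem_range, mem_ofPred_eq] at hg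
  obtain ⟨K₁, hK₁⟩ := exists_forall_lt_mem_of_isOpen (hU.preimage M.continuous_diagram) hv
  obtain ⟨K₂, hK₂⟩ := exists_forall_lt_mem_of_isOpen (hU.preimage B.reduct.continuous_diagram) hgU
  set k := max n (max K₁ K₂) with hk
  obtain ⟨C, hC, hvC, hCU⟩ := exists_compact_subset hU' hv'
  obtain ⟨j, hj, hl⟩ := hB.exists_realization hC hU' hCU
    ((Finset.range n).image fun i => (h i, g i)) (r := 3 * ε) (r' := 4 * ε) (by linarith) (by
      intro P hP hBP
      have hsh := continuous_comp_relabel (L := L) fun i => k + i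
      -- Both spliced sequences start with a segment long enough to stay in `U`. Goodness
      -- amalgamates them over the first `n` entries, and the tails carry the conditions `P` and
      -- `C`. Two links within the sequences and one between them add up to `3 * ε`.
      let u₁ : ℕ → B.reduct.carrier := splice k (fun i => B.const (g i)) B.const
      let u₂ : ℕ → M.carrier := splice k v v'
      have hu₁ : ∀ i, u₁ (k + i) = B.const i := congrFun (splice_comp_add k _ _)
      have hu₂ : ∀ i, u₂ (k + i) = v' i := congrFun (splice_comp_add k _ _)
      obtain ⟨N, hN, v₁, v₂, hv₁, hv₂, hd⟩ := hgood
        (U ∩ (fun x => x ∘ Atom.relabel fun i => k + i) ⁻¹' P ∩ closeSet L n (fun i => k + g i) ε)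
        (U ∩ (fun x => x ∘ Atom.relabel fun i => k + i) ⁻¹' (interior C) ∩
          closeSet L n (fun i => k + h i) ε)
        ((hU.inter (hP.preimage hsh)).inter (isOpen_closeSet _ _ _))
        ((hU.inter (isOpen_interior.preimage hsh)).inter (isOpen_closeSet _ _ _))
        (inter_subset_left.trans inter_subset_left) (inter_subset_left.trans inter_subset_left)
        (by
          refine ⟨B.reduct.diagram u₁, ⟨⟨hK₂ _ fun i hi => splice_of_lt _ _ (by omega), ?_⟩, ?_⟩,
            B.reduct, hBT, u₁, rfl⟩
          · rw [mem_preimage, ← B.reduct.diagram_comp, splice_comp_add]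
            exact hBP
          · refine diagram_mem_closeSet.2 fun i hi => ?_
            rw [hu₁, show u₁ i = B.const (g i) from splice_of_lt _ _ (by omega), dist_self]
            exact hε)
        (by
          refine ⟨M.diagram u₂, ⟨⟨hK₁ _ fun i hi => splice_of_lt _ _ (by omega), ?_⟩, ?_⟩,
            M, hM, u₂, rfl⟩
          · rw [mem_preimage, ← M.diagram_comp, splice_comp_add]
            exact hvC
          · refine diagram_mem_closeSet.2 fun i hi => ?_
            rw [hu₂, show u₂ i = v i from splice_of_lt _ _ (by omega), dist_comm]
            exact hh i hi)
      refine ⟨N, hN, v₁ ∘ fun i => k + i, v₂ ∘ fun i => k + i, ?_, ?_, ?_⟩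
      · rw [N.diagram_comp]
        exact hv₁.1.2
      · rw [N.diagram_comp]
        exact interior_subset hv₂.1.2
      · intro z hz
        obtain ⟨i, hi, rfl⟩ := Finset.mem_image.1 hz
        have hi := Finset.mem_range.1 hi
        have h1 := diagram_mem_closeSet.1 hv₁.2 i hi
        have h2 := diagram_mem_closeSet.1 hv₂.2 i hi
        have h3 := hd i hi
        have h5 := dist_triangle4 (v₂ (k + h i)) (v₂ i) (v₁ i) (v₁ (k + g i))
        rw [dist_comm (v₂ (k + h i)) (v₂ i), dist_comm (v₂ i) (v₁ i)] at h5
        simp only [Function.comp_apply]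
        linarith)
  refine ⟨B.const ∘ j, hj, fun i hi => ?_⟩
  have h1 := hl (h i, g i) (Finset.mem_image.2 ⟨i, Finset.mem_range.2 hi, rfl⟩)
  have h2 := hg i hi
  have h3 := dist_triangle (B.const (j (h i))) (B.const (g i)) (w i)
  simp only [Function.comp_apply] at h1 ⊢
  linarith

/-- A deciding enumeration of a model of `T` all of whose finite parts have good diagrams. -/
structure IsGeneric (T : Theory L) (A : StrC L) : Prop extends IsDeciding T A where
  models : A.reduct.Models T
  exists_isGood : ∀ (n : ℕ) (ε : ℝ), 0 < ε → ∃ U, IsOpen U ∧ IsGood T U n ε ∧ A.diagram ∈ U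

/-- One round of an approximate back-and-forth between generic structures. -/
theorem IsGeneric.exists_round {A B : StrC L} (hA : IsGeneric T A) (hB : IsGeneric T B)
    {U : Set (Atom L → I)} (hU : IsOpen U) {n : ℕ} {ε : ℝ} (hε : 0 < ε) (hgood : IsGood T U n ε)
    (hAU : A.diagram ∈ U) {w : ℕ → B.reduct.carrier} (hw : B.reduct.diagram w ∈ U)
    {V : Set (Atom L → I)} (hV : IsOpen V) (hAV : A.diagram ∈ V) {ε' : ℝ} (hε' : 0 < ε') (m : ℕ) :
    ∃ (U' : Set (Atom L → I)) (n' : ℕ) (w' : ℕ → B.reduct.carrier),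
      (IsOpen U' ∧ IsGood T U' n' ε' ∧ A.diagram ∈ U' ∧ B.reduct.diagram w' ∈ U') ∧
      U' ⊆ V ∧ n ≤ n' ∧ m ≤ n' ∧ (∀ i < n, dist (w' i) (w i) < 13 * ε) ∧
      ∀ k < m, ∃ i < n', dist (w' i) (B.const k) < 5 * ε := by
  choose h hh using fun i => hB.denseRange_const.exists_dist_lt (w i) hε
  set l := max m ((Finset.range n).sup h + 1) with hl
  have hhl : ∀ i < n, h i < l := fun i hi => by
    have := Finset.le_sup (f := h) (Finset.mem_range.2 hi)
    omega
  obtain ⟨R, hR, hRgood, hBR⟩ := hB.exists_isGood l ε hε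
  -- Back: the constants of `B` are copied approximately into `A` as `u`, so that `h i` lands near
  -- the `i`-th constant of `A`.
  obtain ⟨u, huR, hu⟩ := hA.toIsDeciding.exists_transfer hA.models hU hε hgood hB.models hw hAU hR
    hBR h fun i _ => by rw [dist_comm]; exact hh i
  choose h' hh' using fun i => hA.denseRange_const.exists_dist_lt (u i) hε
  set n' := max (max m n) ((Finset.range l).sup h' + 1) with hn'
  have hhn' : ∀ i < l, h' i < n' := fun i hi => by
    have := Finset.le_sup (f := h') (Finset.mem_range.2 hi)
    omega
  obtain ⟨U₀, hU₀, hU₀good, hAU₀⟩ := hA.exists_isGood n' ε' hε'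
  -- In `A` these constants are within `5 * ε + ε`. Membership in `closeSet` passes this to `w'`,
  -- giving `7 * ε + 5 * ε + ε` as the total shift from `w`.
  have hU'open : IsOpen (U₀ ∩ V ∩ closeSet L n (fun i => h' (h i)) (7 * ε)) :=
    (hU₀.inter hV).inter (isOpen_closeSet _ _ _)
  have hAU' : A.diagram ∈ U₀ ∩ V ∩ closeSet L n (fun i => h' (h i)) (7 * ε) := by
    refine ⟨⟨hAU₀, hAV⟩, diagram_mem_closeSet.2 fun i hi => ?_⟩
    have h1 := hu i hi
    have h2 := hh' (h i)
    have h3 := dist_triangle_left (A.const i) (A.const (h' (h i))) (u (h i))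
    linarith
  -- Forth: the constants of `A` are copied into `B` over the pair `u` and `B.const`.
  obtain ⟨w', hw'U, hw'⟩ := hB.toIsDeciding.exists_transfer hB.models hR hε hRgood hA.models huR hBR
    hU'open hAU' h' fun i _ => by rw [dist_comm]; exact hh' i
  refine ⟨_, n', w', ⟨hU'open, hU₀good.mono (inter_subset_left.trans inter_subset_left) le_rfl, hAU',
    hw'U⟩, inter_subset_left.trans inter_subset_right, by omega, by omega, fun i hi => ?_,
    fun k hk => ⟨h' k, hhn' k (by omega), hw' k (by omega)⟩⟩
  have h1 := diagram_mem_closeSet.1 hw'U.2 i hi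
  have h2 := hw' (h i) (hhl i hi)
  have h3 := hh i
  rw [dist_comm] at h3
  have h4 := dist_triangle4 (w' i) (w' (h' (h i))) (B.const (h i)) (w i)
  linarith

/-- A stage of the back-and-forth: a good open set containing the diagram of `A` and of a sequence
in `B`. -/
structure Stage (T : Theory L) (A B : StrC L) (ε : ℝ) where
  U : Set (Atom L → I)
  n : ℕ
  w : ℕ → B.reduct.carrier
  isOpen : IsOpen U
  isGood : IsGood T U n ε
  mem_left : A.diagram ∈ U
  mem_right : B.reduct.diagram w ∈ U

/-- Rounds with precision `(1 / 2) ^ k` yield sequences in `B` that converge entrywise. The open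
sets shrink to the diagram of `A`, so the limit has that diagram, and the back steps make it dense
in `B`. -/
theorem IsGeneric.isomorphic {A B : StrC L} (hJEP : T.JEP) (hA : IsGeneric T A)
    (hB : IsGeneric T B) : Isomorphic A.reduct B.reduct := by
  obtain ⟨V, hV⟩ := (𝓝 A.diagram).exists_antitone_basis
  have hVm : ∀ k, A.diagram ∈ interior (V k) := fun k =>
    mem_interior_iff_mem_nhds.2 (hV.1.mem_of_mem trivial)
  have hpos : ∀ k : ℕ, (0 : ℝ) < (1 / 2) ^ k := fun k => by positivity
  have step : ∀ (k : ℕ) (s : Stage T A B ((1 / 2) ^ k)), ∃ s' : Stage T A B ((1 / 2) ^ (k + 1)),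
      s'.U ⊆ V k ∧ s.n ≤ s'.n ∧ k ≤ s'.n ∧ (∀ i < s.n, dist (s'.w i) (s.w i) < 13 * (1 / 2) ^ k) ∧
      ∀ j < k, ∃ i < s'.n, dist (s'.w i) (B.const j) < 5 * (1 / 2) ^ k := by
    intro k s
    obtain ⟨U', n', w', ⟨h1, h2, h3, h4⟩, h5, h6⟩ := hA.exists_round hB s.isOpen (hpos k) s.isGood
      s.mem_left s.mem_right isOpen_interior (hVm k) (hpos (k + 1)) k
    exact ⟨⟨U', n', w', h1, h2, h3, h4⟩, h5.trans interior_subset, h6⟩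
  choose next hU hn hk hd hb using step
  let S : ∀ k, Stage T A B ((1 / 2) ^ k) := fun k => Nat.rec
    ⟨univ, 0, B.const, isOpen_univ, isGood_univ_zero hJEP _, mem_univ _, mem_univ _⟩ next k
  have hS : ∀ k, S (k + 1) = next k (S k) := fun k => rfl
  have hmono : Monotone fun k => (S k).n := monotone_nat_of_le_succ fun k => hn k (S k)
  have hlt : ∀ i, i < (S (i + 2)).n := fun i => hk (i + 1) (S (i + 1))
  have hdist : ∀ k₀ i, i < (S k₀).n → ∀ k, dist ((S (k₀ + k)).w i) ((S (k₀ + (k + 1))).w i) ≤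
      26 * (1 / 2) ^ k₀ / 2 / 2 ^ k := by
    intro k₀ i hi k
    rw [dist_comm]
    refine (hd (k₀ + k) (S (k₀ + k)) i (hi.trans_le (hmono (by omega)))).le.trans (le_of_eq ?_)
    rw [pow_add, one_div_pow (2 : ℝ) k]
    ring
  have hshift : ∀ (g : ℕ → B.reduct.carrier) (k : ℕ) (y : B.reduct.carrier),
      Tendsto (fun n => g (k + n)) atTop (𝓝 y) ↔ Tendsto g atTop (𝓝 y) := fun g k y => by
    simpa only [add_comm] using tendsto_add_atTop_iff_nat (f := g) k
  have hlim : ∀ i, ∃ y, Tendsto (fun k => (S k).w i) atTop (𝓝 y) := by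
    intro i
    obtain ⟨y, hy⟩ := cauchySeq_tendsto_of_complete
      (cauchySeq_of_le_geometric_two (hdist (i + 2) i (hlt i)))
    exact ⟨y, (hshift (fun k => (S k).w i) (i + 2) y).1 hy⟩
  choose f hf using hlim
  have hfd : ∀ k i, i < (S k).n → dist ((S k).w i) (f i) ≤ 26 * (1 / 2) ^ k := by
    intro k i hi
    exact dist_le_of_le_geometric_two_of_tendsto₀ (hdist k i hi)
      ((hshift (fun k => (S k).w i) k (f i)).2 (hf i))
  have hdiag : A.reduct.diagram A.const = B.reduct.diagram f := by
    have h1 : Tendsto (fun k => B.reduct.diagram (S k).w) atTop (𝓝 (B.reduct.diagram f)) :=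
      (B.reduct.continuous_diagram.tendsto f).comp (tendsto_pi_nhds.2 hf)
    have h2 : Tendsto (fun k => B.reduct.diagram (S (k + 1)).w) atTop (𝓝 A.diagram) :=
      hV.tendsto fun k => hU k (S k) (S (k + 1)).mem_right
    exact tendsto_nhds_unique h2 ((tendsto_add_atTop_iff_nat 1).2 h1)
  have hfdense : DenseRange f := by
    rw [DenseRange, ← dense_closure]
    refine hB.denseRange_const.mono ?_
    rintro _ ⟨j, rfl⟩
    refine Metric.mem_closure_range_iff.2 fun ε hε => ?_
    -- The error is `5 * (1 / 2) ^ k` from the round plus `26 * (1 / 2) ^ (k + 1)` from the limit.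
    obtain ⟨k₀, hk₀⟩ := exists_pow_lt_of_lt_one (show 0 < ε / 18 by positivity)
      (show (1 / 2 : ℝ) < 1 by norm_num)
    set k := max k₀ (j + 1)
    have hkk : (1 / 2 : ℝ) ^ k ≤ (1 / 2) ^ k₀ :=
      pow_le_pow_of_le_one (by norm_num) (by norm_num) (le_max_left _ _)
    obtain ⟨i, hi, hij⟩ := hb k (S k) j (lt_of_lt_of_le (Nat.lt_succ_self j) (le_max_right _ _))
    have h1 := hfd (k + 1) i hi
    rw [hS] at h1
    have h2 := dist_triangle_left (B.const j) (f i) ((next k (S k)).w i)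
    have h3 : (1 / 2 : ℝ) ^ (k + 1) = (1 / 2) ^ k * (1 / 2) := pow_succ _ _
    exact ⟨i, by linarith⟩
  refine isomorphic_of_diagram_eq hdiag hA.dense (hfdense.mono ?_)
  rintro _ ⟨i, rfl⟩
  exact ⟨.var i, rfl⟩

end ContLogic

namespace ContLogic

/-! ### The game as a Banach–Mazur game -/

open Topology Set Filter

variable {L : Signature.{u}}

/-- An unsatisfiable outcome would entail every value, against uniqueness. So the outcome has a
model, whose diagram is that of `A`; that `A` itself models `T` is not claimed. -/
theorem WonByExists.exists_compiled {T : Theory L} {P : StrC L → Prop} {p : ℕ → Condition T}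
    (h : WonByExists T P p) : ∃ A : StrC L, P A ∧ A.diagram ∈ modelDiagrams T ∧
      (∀ n, A.Satisfies (p n).exprs) ∧
      DenseRange fun t : L.Term ℕ => A.reduct.termVal A.const t := by
  obtain ⟨hdef, A, ⟨hval, hdense⟩, hP⟩ := h
  obtain ⟨B, hBT, hB⟩ : ∃ B : StrC L, B.Models T (⋃ n, (p n).exprs) := by
    by_contra! hno
    obtain ⟨r, -, hr⟩ := hdef (.dist (.var (.inl 0)) (.var (.inl 0))) (.dist _ _)
    have h0 := hr 0 fun B hB => absurd hB (hno B)
    have h1 := hr 1 fun B hB => absurd hB (hno B)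
    exact zero_ne_one (h0.trans h1.symm)
  have hAB : A.diagram = B.diagram := by
    funext a
    obtain ⟨r, hr, -⟩ := hdef a.toFormula a.toFormula_isAtomic
    rw [← A.val_toFormula, ← B.val_toFormula, hval _ a.toFormula_isAtomic r hr, hr B ⟨hBT, hB⟩]
  refine ⟨A, hP, ⟨B.reduct, hBT, B.const, hAB.symm⟩, fun n e he => ?_, hdense⟩
  rw [StrC.val_eq_of_diagram_eq e.restricted.isQF hAB]
  exact hB e (mem_iUnion.2 ⟨n, he⟩)

/-- The run in which one player follows `s` and the other one follows `τ`. -/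
theorem exists_play {α : Type*} (s : List α → α) (a : α) (τ : ℕ → α → α) :
    ∃ p : ℕ → α, p 0 = τ 0 a ∧ (∀ k, p (2 * k + 1) = s ((List.range (2 * k + 1)).map p)) ∧
      ∀ k, p (2 * k + 2) = τ (k + 1) (p (2 * k + 1)) := by
  -- The default `a` is read only at the empty history, where it is the argument of `τ 0`.
  let move : List α → α := fun l =>
    if l.length % 2 = 1 then s l else τ (l.length / 2) (l.getLast?.getD a)
  obtain ⟨hist, hzero, hsucc⟩ : ∃ hist : ℕ → List α, hist 0 = [] ∧
      ∀ n, hist (n + 1) = hist n ++ [move (hist n)] :=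
    ⟨fun n => Nat.rec [] (fun _ l => l ++ [move l]) n, rfl, fun _ => rfl⟩
  have hlen : ∀ n, (hist n).length = n := by
    intro n
    induction n with
    | zero => simp [hzero]
    | succ n ih => rw [hsucc]; simp [ih]
  have hmap : ∀ n, hist n = (List.range n).map fun k => move (hist k) := by
    intro n
    induction n with
    | zero => simp [hzero]
    | succ n ih => rw [List.range_succ, List.map_append, ← ih, hsucc]; rfl
  refine ⟨fun n => move (hist n), by simp [move, hzero], fun k => ?_, fun k => ?_⟩
  · rw [← hmap]
    exact if_pos (by rw [hlen]; omega)
  · have h1 : (hist (2 * k + 2)).getLast?.getD a = move (hist (2 * k + 1)) := by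
      rw [hsucc]; simp
    change (if (hist (2 * k + 2)).length % 2 = 1 then _ else _) = _
    rw [if_neg (by rw [hlen]; omega), h1, hlen]
    congr 1
    omega

/-- Runs against the same strategy agree as long as the moves of the other player do. -/
theorem play_congr {α : Type*} {s : List α → α} {a : α} {τ τ' : ℕ → α → α} {p p' : ℕ → α}
    (h0 : p 0 = τ 0 a) (h1 : ∀ k, p (2 * k + 1) = s ((List.range (2 * k + 1)).map p))
    (h2 : ∀ k, p (2 * k + 2) = τ (k + 1) (p (2 * k + 1))) (h0' : p' 0 = τ' 0 a)
    (h1' : ∀ k, p' (2 * k + 1) = s ((List.range (2 * k + 1)).map p'))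
    (h2' : ∀ k, p' (2 * k + 2) = τ' (k + 1) (p' (2 * k + 1))) {m : ℕ}
    (hτ : ∀ k < m, τ k = τ' k) : ∀ n < 2 * m, p n = p' n := by
  intro n
  induction n using Nat.strong_induction_on with
  | _ n ih =>
    intro hn
    rcases Nat.even_or_odd' n with ⟨k, rfl | rfl⟩
    · rcases k with _ | k
      · exact h0.trans ((congrFun (hτ 0 (by omega)) a).trans h0'.symm)
      · have h3 := ih (2 * k + 1) (by omega) (by omega)
        change p (2 * k + 2) = p' (2 * k + 2)
        rw [h2, h2', hτ (k + 1) (by omega), h3]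
    · rw [h1, h1']
      congr 1
      exact List.map_congr_left fun i hi => ih i (List.mem_range.1 hi) (by
        have := List.mem_range.1 hi; omega)

theorem Condition.nonempty_of_satisfiable {T : Theory L} (hsat : T.Satisfiable) :
    Nonempty (Condition T) := by
  obtain ⟨M, hM⟩ := hsat
  exact ⟨⟨∅, finite_empty, ⟨M, fun _ => Classical.arbitrary _⟩, hM, by simp⟩⟩

theorem Enforceable.exists_strC {T : Theory L} (hsat : T.Satisfiable) {P : StrC L → Prop}
    (h : Enforceable T P) : ∃ A : StrC L, P A := by
  obtain ⟨s, hs⟩ := h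
  obtain ⟨p₀⟩ := Condition.nonempty_of_satisfiable hsat
  obtain ⟨p, -, h1, h2⟩ := exists_play s p₀ fun _ q => q
  obtain ⟨A, hA, -⟩ := (hs p h1 fun k => (h2 k ▸ Subset.rfl)).2.exists_compiled
  exact ⟨A, hA⟩

theorem Enforceable.mono {T : Theory L} {P Q : StrC L → Prop} (h : Enforceable T P) (hPQ : ∀ A, P A → Q A) :
    Enforceable T Q := by
  obtain ⟨s, hs⟩ := h
  refine ⟨s, fun p h1 h2 => ⟨(hs p h1 h2).1, (hs p h1 h2).2.1, ?_⟩⟩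
  obtain ⟨A, hA, hP⟩ := (hs p h1 h2).2.2
  exact ⟨A, hA, hPQ A hP⟩

/-- A move of `∃` towards a dense open set and a small diameter in the direction of an atomic
sentence, which also strengthens the strict inequalities of the previous move. -/
theorem Condition.exists_move {T : Theory L} (p : Condition T) {W : Set (Atom L → I)}
    (hW : IsOpen W) (hWd : DenseInModels T W) (a : Atom L) {δ : ℝ} (hδ : 0 < δ) :
    ∃ (q : Condition T) (t : Set (Atom L → I)), p.exprs ⊆ q.exprs ∧ IsClosed t ∧
      (∀ B : StrC L, B.Satisfies q.exprs → B.diagram ∈ t) ∧ t ⊆ W ∧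
      (∀ B : StrC L, B.diagram ∈ t → B.Satisfies p.exprs) ∧
      ∀ x ∈ t, ∀ y ∈ t, dist (x a) (y a) < δ := by
  obtain ⟨U, hU, hpU⟩ := exists_isOpen_of_finite p.finite
  obtain ⟨A, hAT, hA⟩ := p.satisfiable
  obtain ⟨_, ⟨hBU, hBW⟩, M, hM, v, rfl⟩ :=
    hWd U hU ⟨A.diagram, (hpU A).1 hA, A.reduct, hAT, A.const, rfl⟩
  let B : StrC L := ⟨M, v⟩
  have hball : IsOpen {x : Atom L → I | dist (x a) (B.diagram a) < δ / 2} :=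
    isOpen_lt ((continuous_apply a).dist continuous_const) continuous_const
  obtain ⟨t, htn, htc, hts⟩ := exists_mem_nhds_isClosed_subset
    (((hU.inter hW).inter hball).mem_nhds (show B.diagram ∈ _ from ⟨⟨hBU, hBW⟩, by simp [hδ]⟩))
  obtain ⟨q, hpq, hq⟩ := p.exists_extension isOpen_interior hM ((hpU B).2 hBU)
    (mem_interior_iff_mem_nhds.2 htn)
  refine ⟨q, t, hpq, htc, fun C hC => interior_subset (hq C hC), fun x hx => (hts hx).1.2,
    fun C hC => (hpU C).2 (hts hC).1.1, fun x hx y hy => ?_⟩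
  have h1 : dist (x a) (B.diagram a) < δ / 2 := (hts hx).2
  have h2 : dist (y a) (B.diagram a) < δ / 2 := (hts hy).2
  have h3 := dist_triangle_right (x a) (y a) (B.diagram a)
  linarith

/-- Properties that hold on a countable intersection of dense open sets are enforceable. -/
theorem enforceable_of_denseInModels [Countable (Atom L)] {T : Theory L} (hsat : T.Satisfiable)
    {ι : Type*} [Countable ι] [Nonempty ι] {W : ι → Set (Atom L → I)} (hW : ∀ i, IsOpen (W i))
    (hWd : ∀ i, DenseInModels T (W i)) {Q : StrC L → Prop}
    (hQ : ∀ A : StrC L, (DenseRange fun t : L.Term ℕ => A.reduct.termVal A.const t) →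
      A.diagram ∈ closure (modelDiagrams T) → (∀ i, A.diagram ∈ W i) →
      A.reduct.Models T ∧ Q A) : Enforceable T Q := by
  have hne := Condition.nonempty_of_satisfiable hsat
  have : Nonempty (Atom L) := ⟨.inl (.var 0, .var 0)⟩
  -- Each round has an open set to enter, an atomic sentence and a precision for its value.
  obtain ⟨e, he⟩ := exists_surjective_nat (ι × Atom L × ℕ)
  choose q t hpq htc hqt htW htp htd using fun (m : ℕ) (p : Condition T) =>
    p.exists_move (hW (e m).1) (hWd (e m).1) (e m).2.1 (Nat.one_div_pos_of_nat (n := (e m).2.2))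
  -- In round `k` the history has length `2 * k + 1`, so it is never empty when `∃` moves.
  refine ⟨fun l => if h : l = [] then Classical.choice hne else
    q ((l.length - 1) / 2) (l.getLast h), fun p hs hrule => ?_⟩
  have hmove : ∀ k, p (2 * k + 1) = q k (p (2 * k)) := by
    intro k
    rw [hs k]
    beta_reduce
    rw [dif_neg (by simp)]
    simp
  have hstep : ∀ k, (p (2 * k)).exprs ⊆ (p (2 * k + 1)).exprs := fun k => by
    rw [hmove]; exact hpq k _
  have hmono : Monotone fun k => (p k).exprs := by
    refine monotone_nat_of_le_succ fun k => ?_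
    rcases Nat.even_or_odd' k with ⟨m, rfl | rfl⟩
    · exact hstep m
    · exact hrule m
  let D : ℕ → Set (Atom L → I) := fun k =>
    {x | ∃ B : StrC L, B.reduct.Models T ∧ B.Satisfies (p (2 * k + 1)).exprs ∧ B.diagram = x}
  have hDt : ∀ k, D k ⊆ t k (p (2 * k)) := by
    rintro k _ ⟨B, -, hB, rfl⟩
    rw [hmove] at hB
    exact hqt k _ B hB
  -- A diagram for the limit of the play comes from compactness. The closed sets `t` preserve the
  -- strict inequalities of the moves there.
  obtain ⟨x, hx⟩ := IsCompact.nonempty_iInter_of_sequence_nonempty_isCompact_isClosed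
    (fun k => closure (D k)) (fun k => closure_mono (by
      rintro _ ⟨B, hT, hB, rfl⟩
      exact ⟨B, hT, fun e he => hB e (hmono (by omega) he), rfl⟩))
    (fun k => by
      obtain ⟨B, hT, hB⟩ := (p (2 * k + 1)).satisfiable
      exact ⟨B.diagram, subset_closure ⟨B, hT, hB, rfl⟩⟩)
    isClosed_closure.isCompact (fun k => isClosed_closure)
  have hxt : ∀ k, x ∈ t k (p (2 * k)) := fun k =>
    closure_minimal (hDt k) (htc k _) (mem_iInter.1 hx k)
  have hxT : x ∈ closure (modelDiagrams T) := by
    refine closure_mono ?_ (mem_iInter.1 hx 0)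
    rintro _ ⟨B, hT, -, rfl⟩
    exact ⟨B.reduct, hT, B.const, rfl⟩
  obtain ⟨A, rfl, hAd⟩ := exists_strC_of_mem_closure hxT
  obtain ⟨hAT, hQA⟩ := hQ A hAd hxT fun i => by
    obtain ⟨m, hm⟩ := he (i, Classical.arbitrary _, 0)
    have := htW m _ (hxt m)
    rwa [hm] at this
  have hAp : A.Models T (⋃ n, (p n).exprs) := by
    refine ⟨hAT, fun e he => ?_⟩
    obtain ⟨n, hn⟩ := mem_iUnion.1 he
    exact htp n _ A (hxt n) e (hmono (by omega : n ≤ 2 * n) hn)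
  have huniq : ∀ B : StrC L, B.Models T (⋃ n, (p n).exprs) → B.diagram = A.diagram := by
    intro B hB
    funext a
    refine eq_of_forall_dist_le fun ε hε => ?_
    obtain ⟨n, hn⟩ := exists_nat_one_div_lt hε
    obtain ⟨m, hm⟩ := he (Classical.arbitrary _, a, n)
    have hBt : B.diagram ∈ t m (p (2 * m)) := hqt m _ B fun e he => hB.2 e (mem_iUnion.2
      ⟨2 * m + 1, by rwa [hmove]⟩)
    have := htd m _ _ hBt _ (hxt m)
    rw [hm] at this
    exact (this.trans hn).le
  have hent : ∀ φ : SentenceC L, φ.IsAtomic → Entails T (⋃ n, (p n).exprs) φ (A.val φ) :=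
    fun φ hφ B hB => StrC.val_eq_of_diagram_eq (.atomic hφ) (huniq B hB)
  exact ⟨hstep, fun φ hφ => ⟨A.val φ, hent φ hφ, fun r hr => (hr A hAp).symm⟩, A,
    ⟨fun φ _ r hr => hr A hAp, hAd⟩, hQA⟩

/-! ### Enforcing genericity. -/

variable [Countable (Atom L)] {T : Theory L}

/-- Indices of the deciding sets. -/
abbrev DecidingIndex (L : Signature.{u}) [Countable (Atom L)] : Type u :=
  basicOpens L × Finset (ℕ × ℕ) × ℚ

/-- The deciding set with a given index. -/
def decidingFamily (T : Theory L) (i : DecidingIndex L) : Set (Atom L → I) :=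
  decidingSet T i.1 i.2.1 i.2.2

instance countable_decidingIndex : Countable (DecidingIndex L) :=
  have := (countable_basicOpens (L := L)).to_subtype
  inferInstance

instance nonempty_decidingIndex : Nonempty (DecidingIndex L) :=
  ⟨⟨⟨⋃₀ ∅, ∅, ⟨finite_empty, empty_subset _⟩, rfl⟩, ∅, 0⟩⟩

theorem isOpen_decidingFamily (i : DecidingIndex L) : IsOpen (decidingFamily T i) :=
  isOpen_decidingSet T (isOpen_of_mem_basicOpens i.1.2) _ _

theorem isDeciding_of_mem {A : StrC L}
    (hd : DenseRange fun t : L.Term ℕ => A.reduct.termVal A.const t)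
    (hc : A.diagram ∈ closure (modelDiagrams T)) (h : ∀ i, A.diagram ∈ decidingFamily T i) :
    IsDeciding T A :=
  ⟨hc, fun U hU l r => h (⟨U, hU⟩, l, r), hd⟩

/-- If good open sets are dense, genericity is enforceable. -/
theorem enforceable_isGeneric (hsat : T.Satisfiable) (hT : T.ForallExistsAxiomatizable)
    (hgood : ∀ (n : ℕ) (ε : ℝ), 0 < ε → ∀ V, IsOpen V → (V ∩ modelDiagrams T).Nonempty →
      ∃ U ⊆ V, IsOpen U ∧ (U ∩ modelDiagrams T).Nonempty ∧ IsGood T U n ε) :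
    Enforceable T (IsGeneric T) := by
  refine enforceable_of_denseInModels (ι := DecidingIndex L ⊕ ℕ × ℕ)
    (W := Sum.elim (decidingFamily T)
      fun z => ⋃₀ {U | IsOpen U ∧ IsGood T U z.1 (1 / ((z.2 : ℝ) + 1))}) hsat ?_ ?_ ?_
  · rintro (i | z)
    · exact isOpen_decidingFamily i
    · exact isOpen_sUnion fun U hU => hU.1
  · rintro (i | z)
    · exact denseInModels_decidingSet T _ _ _
    · intro V hV hne
      obtain ⟨U, hUV, hU, ⟨x, hxU, hxT⟩, hg⟩ := hgood z.1 _ (Nat.one_div_pos_of_nat (n := z.2)) V hV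
        hne
      exact ⟨x, ⟨hUV hxU, U, ⟨hU, hg⟩, hxU⟩, hxT⟩
  · intro A hd hc hW
    have hA : IsDeciding T A := isDeciding_of_mem hd hc fun i => hW (.inl i)
    refine ⟨hA.models hT, hA, hA.models hT, fun n ε hε => ?_⟩
    obtain ⟨m, hm⟩ := exists_nat_one_div_lt hε
    obtain ⟨U, ⟨hU, hg⟩, hAU⟩ := hW (.inr (n, m))
    exact ⟨U, hU, hg.mono Subset.rfl hm.le, hAU⟩

end ContLogic

namespace ContLogic

/-! ### Counting isomorphism classes -/

open Topology Set Filter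

variable {L : Signature.{u}}

theorem Isomorphic.refl (M : Str L) : Isomorphic M M :=
  ⟨⟨id, isometry_id, fun _ _ => rfl, fun _ _ => rfl⟩, Function.surjective_id⟩

theorem isomorphic_of_isoClass_eq {M N : Str L} (h : isoClass M = isoClass N) : Isomorphic M N := by
  have : N ∈ isoClass N := Isomorphic.refl N
  rwa [← h] at this

/-- Two extensions of a condition that cannot be realized in a common model by tuples close to each
other. -/
theorem Condition.exists_split {T : Theory L} (p : Condition T) {n : ℕ} {ε : ℝ}
    {V : Set (Atom L → I)} (hV : IsOpen V)
    (hbad : ∀ U ⊆ V, IsOpen U → (U ∩ modelDiagrams T).Nonempty → ¬ IsGood T U n ε)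
    (hpV : ∀ B : StrC L, B.Satisfies p.exprs → B.diagram ∈ V) {W : Set (Atom L → I)}
    (hW : IsOpen W) (hWd : DenseInModels T W) :
    ∃ q : Bool → Condition T, (∀ b, p.exprs ⊆ (q b).exprs) ∧
      (∀ b, ∀ B : StrC L, B.Satisfies (q b).exprs → B.diagram ∈ W) ∧
      ∀ M : Str L, M.Models T → ∀ v : Bool → ℕ → M.carrier,
        (∀ b, StrC.Satisfies ⟨M, v b⟩ (q b).exprs) → ∃ i < n, ε < dist (v true i) (v false i) := by
  obtain ⟨U, hU, hpU⟩ := exists_isOpen_of_finite p.finite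
  obtain ⟨A, hAT, hA⟩ := p.satisfiable
  have hnot := hbad (U ∩ V) inter_subset_right (hU.inter hV)
    ⟨A.diagram, ⟨(hpU A).1 hA, hpV A hA⟩, A.reduct, hAT, A.const, rfl⟩
  unfold IsGood at hnot
  push Not at hnot
  obtain ⟨U₁, U₂, hU₁, hU₂, hs₁, hs₂, hn₁, hn₂, hno⟩ := hnot
  have key : ∀ U' ⊆ U ∩ V, IsOpen U' → (U' ∩ modelDiagrams T).Nonempty → ∃ q : Condition T,
      p.exprs ⊆ q.exprs ∧ ∀ B : StrC L, B.Satisfies q.exprs → B.diagram ∈ U' ∩ W := by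
    intro U' hs hU' hn
    obtain ⟨_, hx, M, hM, v, rfl⟩ := hWd U' hU' hn
    exact p.exists_extension (A := ⟨M, v⟩) (hU'.inter hW) hM ((hpU _).2 (hs hx.1).1) hx
  obtain ⟨q₁, hpq₁, hq₁⟩ := key U₁ hs₁ hU₁ hn₁
  obtain ⟨q₂, hpq₂, hq₂⟩ := key U₂ hs₂ hU₂ hn₂
  refine ⟨fun b => cond b q₁ q₂, ?_, ?_, fun M hM v hv => ?_⟩
  · rintro (_ | _)
    exacts [hpq₂, hpq₁]
  · rintro (_ | _) B hB
    exacts [(hq₂ B hB).2, (hq₁ B hB).2]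
  · exact hno M hM (v true) (v false) (hq₁ _ (hv true)).1 (hq₂ _ (hv false)).1

variable [Countable (Atom L)] {T : Theory L}

/-- If good open sets are not dense, there is a Cantor scheme of structures with a given enforceable
property whose distinguished tuples are far from each other in every common model. -/
theorem Enforceable.exists_separated_family {P : StrC L → Prop} (hP : Enforceable T P) {n : ℕ}
    {ε : ℝ} {V : Set (Atom L → I)} (hV : IsOpen V) (hVn : (V ∩ modelDiagrams T).Nonempty)
    (hbad : ∀ U ⊆ V, IsOpen U → (U ∩ modelDiagrams T).Nonempty → ¬ IsGood T U n ε) :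
    ∃ A : (ℕ → Bool) → StrC L, (∀ x, P (A x) ∧ IsDeciding T (A x)) ∧
      ∀ x y, x ≠ y → ∀ M : Str L, M.Models T → ∀ v w : ℕ → M.carrier,
        M.diagram v = (A x).diagram → M.diagram w = (A y).diagram →
        ∃ i < n, ε < dist (v i) (w i) := by
  classical
  obtain ⟨s, hs⟩ := hP
  obtain ⟨e, he⟩ := exists_surjective_nat (DecidingIndex L)
  obtain ⟨p₀, hp₀⟩ : ∃ p₀ : Condition T, ∀ B : StrC L, B.Satisfies p₀.exprs → B.diagram ∈ V := by
    obtain ⟨_, hx, M, hM, v, rfl⟩ := hVn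
    obtain ⟨q, -, hq⟩ := Condition.exists_extension (T := T)
      ⟨∅, finite_empty, ⟨M, v⟩, hM, by simp⟩ hV (A := ⟨M, v⟩) hM (by simp [StrC.Satisfies]) hx
    exact ⟨q, hq⟩
  -- Splitting is available only below `p₀`; elsewhere a trivial choice keeps `q` total.
  have hsplit : ∀ (k : ℕ) (p : Condition T), ∃ q : Bool → Condition T,
      (∀ b, p.exprs ⊆ (q b).exprs) ∧ (p₀.exprs ⊆ p.exprs →
      (∀ b, ∀ B : StrC L, B.Satisfies (q b).exprs → B.diagram ∈ decidingFamily T (e k)) ∧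
      ∀ M : Str L, M.Models T → ∀ v : Bool → ℕ → M.carrier,
        (∀ b, StrC.Satisfies ⟨M, v b⟩ (q b).exprs) →
          ∃ i < n, ε < dist (v true i) (v false i)) := by
    intro k p
    by_cases hp : p₀.exprs ⊆ p.exprs
    · obtain ⟨q, h1, h2⟩ := p.exists_split hV hbad (fun B hB => hp₀ B fun e he => hB e (hp he))
        (isOpen_decidingFamily (T := T) (e k)) (denseInModels_decidingSet T _ _ _)
      exact ⟨q, h1, fun _ => h2⟩
    · exact ⟨fun _ => p, fun _ => Subset.rfl, fun h => absurd h hp⟩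
  choose q hpq hq using hsplit
  -- Player `∀` plays the half chosen by the bit `x k`, entering the `k`-th deciding set as well.
  choose p hp0 hp1 hp2 using fun x : ℕ → Bool => exists_play s p₀ fun k r => q k r (x k)
  have hrule : ∀ x k, (p x (2 * k + 1)).exprs ⊆ (p x (2 * k + 2)).exprs := fun x k => by
    rw [hp2]; exact hpq _ _ _
  have hwin := fun x => hs (p x) (hp1 x) (hrule x)
  have hmono : ∀ x, Monotone fun k => (p x k).exprs := by
    refine fun x => monotone_nat_of_le_succ fun k => ?_
    rcases Nat.even_or_odd' k with ⟨m, rfl | rfl⟩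
    · exact (hwin x).1 m
    · exact hrule x m
  have hp₀p : ∀ x k, p₀.exprs ⊆ (p x k).exprs := fun x k => by
    refine Subset.trans ?_ (hmono x (Nat.zero_le k))
    simp only [hp0]
    exact hpq _ _ _
  -- Runs whose bits agree before `k` reach the same `r`, so at the first difference the two moves
  -- are the two halves of one split.
  have heven : ∀ x k, ∃ r : Condition T, p₀.exprs ⊆ r.exprs ∧ p x (2 * k) = q k r (x k) ∧
      ∀ y, (∀ j < k, x j = y j) → p y (2 * k) = q k r (y k) := by
    rintro x (_ | k)
    · exact ⟨p₀, Subset.rfl, hp0 x, fun y _ => hp0 y⟩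
    · refine ⟨p x (2 * k + 1), hp₀p x _, hp2 x k, fun y hy => ?_⟩
      rw [play_congr (τ := fun k r => q k r (x k)) (τ' := fun k r => q k r (y k)) (hp0 x) (hp1 x) (hp2 x) (hp0 y) (hp1 y)
        (hp2 y) (m := k + 1) (fun j hj => by simp only [hy j hj]) (2 * k + 1) (by omega)]
      exact hp2 y k
  choose A hPA hAT hAp hAd using fun x => (hwin x).2.exists_compiled
  refine ⟨A, fun x => ⟨hPA x, isDeciding_of_mem (hAd x) (subset_closure (hAT x)) fun i => ?_⟩, ?_⟩
  · obtain ⟨k, rfl⟩ := he i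
    obtain ⟨r, hr, hpr, -⟩ := heven x k
    have := hAp x (2 * k)
    rw [hpr] at this
    exact (hq k r hr).1 _ _ this
  · intro x y hxy M hM v w hv hw
    have hex : ∃ k, x k ≠ y k := Function.ne_iff.1 hxy
    obtain ⟨r, hr, hx, hy⟩ := heven x (Nat.find hex)
    have hy := hy y fun j hj => not_not.1 (Nat.find_min hex hj)
    have hne := Nat.find_spec hex
    set k := Nat.find hex
    have hsat : ∀ (z : ℕ → Bool) (u : ℕ → M.carrier), M.diagram u = (A z).diagram →
        StrC.Satisfies ⟨M, u⟩ (p z (2 * k)).exprs := fun z u hu e he => by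
      rw [StrC.val_eq_of_diagram_eq (A := ⟨M, u⟩) (B := A z) e.restricted.isQF hu]
      exact hAp z _ e he
    have h1 := hsat x v hv
    have h2 := hsat y w hw
    rw [hx] at h1
    rw [hy] at h2
    rcases hxk : x k with _ | _ <;> rcases hyk : y k with _ | _ <;> rw [hxk] at h1 hne <;>
      rw [hyk] at h2 hne
    · exact absurd rfl hne
    · obtain ⟨i, hi, hd⟩ := (hq k r hr).2 M hM (fun b => cond b w v) (by rintro (_ | _) <;> assumption)
      exact ⟨i, hi, by rw [dist_comm]; exact hd⟩
    · exact (hq k r hr).2 M hM (fun b => cond b v w) (by rintro (_ | _) <;> assumption)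
    · exact absurd rfl hne


/-- The balls of radius `ε / 2` around the points are disjoint. -/
theorem countable_of_pairwise_lt_dist {ι Y : Type*} [PseudoMetricSpace Y]
    [TopologicalSpace.SeparableSpace Y] {ε : ℝ} (hε : 0 < ε) {S : Set ι} {g : ι → Y}
    (h : ∀ x ∈ S, ∀ y ∈ S, x ≠ y → ε < dist (g x) (g y)) : S.Countable := by
  refine PairwiseDisjoint.countable_of_isOpen (s := fun x => Metric.ball (g x) (ε / 2)) ?_
    (fun x _ => Metric.isOpen_ball) (fun x _ => Metric.nonempty_ball.2 (by positivity))
  intro x hx y hy hxy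
  refine Metric.ball_disjoint_ball ?_
  linarith [h x hx y hy hxy]

/-- A map from the Cantor space with countable fibres has at least continuum many values. -/
theorem continuum_le_mk_of_countable_fibers {β : Type w} (f : (ℕ → Bool) → β)
    (hf : ∀ z, {x | f x = f z}.Countable) : Cardinal.continuum ≤ Cardinal.mk β := by
  have hf' : ∀ b, {x | f x = b}.Countable := by
    intro b
    by_cases h : ∃ z, f z = b
    · obtain ⟨z, rfl⟩ := h
      exact hf z
    · convert countable_empty
      ext x
      simpa using fun hx => h ⟨x, hx⟩
  choose c hc using fun b => countable_iff_exists_injOn.1 (hf' b)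
  -- A point is determined by its value and its number within the countable fibre; fewer than
  -- continuum many values would leave too few pairs.
  have hinj : Function.Injective fun x => (f x, c (f x) x) := by
    intro x y hxy
    simp only [Prod.mk.injEq] at hxy
    exact hc (f x) rfl hxy.1.symm (by rw [hxy.2, hxy.1])
  have h1 := Cardinal.lift_mk_le_lift_mk_of_injective hinj
  by_contra! hlt
  have h2 : Cardinal.mk (β × ℕ) < Cardinal.continuum := by
    simpa using Cardinal.mul_lt_of_lt Cardinal.aleph0_le_continuum hlt
      Cardinal.aleph0_lt_continuum
  have h3 : Cardinal.lift.{w} (Cardinal.mk (ℕ → Bool)) = Cardinal.continuum := by simp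
  rw [h3, Cardinal.lift_uzero] at h1
  exact h1.not_gt h2

/-- There are at most continuum many separable structures up to isomorphism. -/
theorem mk_isoClassesWith_le (P : StrC L → Prop) :
    Cardinal.mk (isoClassesWith T P) ≤ Cardinal.continuum := by
  have h : ∀ K : isoClassesWith T P, ∃ (M : Str L) (a : ℕ → M.carrier), DenseRange a ∧
      K.1 = isoClass M := by
    rintro ⟨_, A, -, hsep, -, rfl⟩
    obtain ⟨a, ha⟩ := TopologicalSpace.exists_dense_seq A.reduct.carrier
    exact ⟨A.reduct, a, ha, rfl⟩
  choose M a ha hK using h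
  have hinj : Function.Injective fun K => (M K).diagram (a K) := by
    intro K K' h
    have hd : ∀ K, DenseRange fun t : L.Term ℕ => (M K).termVal (a K) t := fun K => by
      refine (ha K).mono ?_
      rintro _ ⟨i, rfl⟩
      exact ⟨.var i, rfl⟩
    apply Subtype.ext
    rw [hK, hK]
    exact isoClass_eq_of_isomorphic (isomorphic_of_diagram_eq h (hd K) (hd K'))
  have h1 := Cardinal.lift_mk_le_lift_mk_of_injective hinj
  have h2 : Cardinal.mk (Atom L → I) ≤ Cardinal.continuum := by
    rw [Cardinal.mk_arrow, Cardinal.mk_Icc_real zero_lt_one, Cardinal.lift_continuum]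
    refine (Cardinal.power_le_power_left Cardinal.continuum_ne_zero ?_).trans
      Cardinal.continuum_power_aleph0.le
    simpa using Cardinal.mk_le_aleph0 (α := Atom L)
  have h3 := h1.trans (Cardinal.lift_le.2 h2)
  simpa using h3

/-- Isomorphisms onto a fixed `A z` carry the constants of the other structures to sequences in `A
z` with the same diagrams. Their initial `n`-tuples are `ε`-separated, so each fibre of the map to
isomorphism classes is countable. -/
theorem continuum_le_mk_isoClassesWith (hT : T.ForallExistsAxiomatizable) {P : StrC L → Prop}
    (hP : Enforceable T P) {n : ℕ} {ε : ℝ} (hε : 0 < ε) {V : Set (Atom L → I)} (hV : IsOpen V)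
    (hVn : (V ∩ modelDiagrams T).Nonempty)
    (hbad : ∀ U ⊆ V, IsOpen U → (U ∩ modelDiagrams T).Nonempty → ¬ IsGood T U n ε) :
    Cardinal.continuum ≤ Cardinal.mk (isoClassesWith T P) := by
  obtain ⟨A, hA, hsep⟩ := hP.exists_separated_family hV hVn hbad
  have hss : ∀ x, TopologicalSpace.SeparableSpace (A x).reduct.carrier := fun x =>
    .of_denseRange _ (hA x).2.denseRange_const
  refine continuum_le_mk_of_countable_fibers (fun x => ⟨isoClass (A x).reduct, A x,
    (hA x).2.models hT, hss x, (hA x).1, rfl⟩) fun z => ?_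
  have hiso : ∀ x, (∃ e : Embedding (A x).reduct (A z).reduct, Function.Surjective e.toFun) ∨
      isoClass (A x).reduct ≠ isoClass (A z).reduct := fun x => by
    by_cases h : isoClass (A x).reduct = isoClass (A z).reduct
    · exact .inl (isomorphic_of_isoClass_eq h)
    · exact .inr h
  have hv : ∀ x, ∃ v : ℕ → (A z).reduct.carrier, isoClass (A x).reduct = isoClass (A z).reduct →
      (A z).reduct.diagram v = (A x).diagram := by
    intro x
    rcases hiso x with ⟨e, -⟩ | h
    · exact ⟨e.toFun ∘ (A x).const, fun _ => e.diagram_comp _⟩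
    · exact ⟨fun _ => Classical.arbitrary _, fun h' => absurd h' h⟩
  choose v hv using hv
  have := hss z
  refine countable_of_pairwise_lt_dist (Y := Fin n → (A z).reduct.carrier) hε
    (g := fun x i => v x i) fun x hx y hy hxy => ?_
  obtain ⟨i, hi, hd⟩ := hsep x y hxy (A z).reduct ((hA z).2.models hT) (v x) (v y)
    (hv x (congrArg Subtype.val hx)) (hv y (congrArg Subtype.val hy))
  exact hd.trans_le (dist_le_pi_dist (fun i : Fin n => v x i) (fun i : Fin n => v y i) ⟨i, hi⟩)

end ContLogic

open ContLogic

theorem mainTheorem4 (L : ContLogic.Signature.{u}) (hL : Countable L.Symbols)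
    (T : ContLogic.Theory L) (hsat : T.Satisfiable) (hT : T.ForallExistsAxiomatizable)
    (hJEP : T.JEP) :
    Xor
      (∀ P : ContLogic.StrC L → Prop, ContLogic.Enforceable T P →
        Cardinal.mk (ContLogic.isoClassesWith T P) = Cardinal.continuum)
      (∃ M : ContLogic.Str L, M.Models T ∧ ContLogic.EnforceableStr T M) := by
  have := countable_atom hL
  have hexcl : (∃ M : Str L, M.Models T ∧ EnforceableStr T M) →
      ¬ ∀ P : StrC L → Prop, Enforceable T P →
        Cardinal.mk (isoClassesWith T P) = Cardinal.continuum := by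
    rintro ⟨M, -, hM⟩ hall
    -- Being isomorphic to `M` is then an enforceable property with at most one class.
    have hsub : (isoClassesWith T fun A => Isomorphic A.reduct M) ⊆ {isoClass M} := by
      rintro _ ⟨A, -, -, hA, rfl⟩
      exact isoClass_eq_of_isomorphic hA
    have h1 := Cardinal.mk_le_mk_of_subset hsub
    rw [hall _ hM, Cardinal.mk_singleton] at h1
    exact h1.not_gt (Cardinal.one_lt_aleph0.trans Cardinal.aleph0_lt_continuum)
  -- The dichotomy is whether good open sets are dense among the diagrams of models.
  by_cases hgood : ∀ (n : ℕ) (ε : ℝ), 0 < ε → ∀ V, IsOpen V → (V ∩ modelDiagrams T).Nonempty →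
      ∃ U ⊆ V, IsOpen U ∧ (U ∩ modelDiagrams T).Nonempty ∧ IsGood T U n ε
  · have hgen := enforceable_isGeneric hsat hT hgood
    obtain ⟨B, hB⟩ := hgen.exists_strC hsat
    have hex : ∃ M : Str L, M.Models T ∧ EnforceableStr T M :=
      ⟨B.reduct, hB.models, hgen.mono fun A hA => hA.isomorphic hJEP hB⟩
    exact .inr ⟨hex, hexcl hex⟩
  · push Not at hgood
    obtain ⟨n, ε, hε, V, hV, hVn, hbad⟩ := hgood
    have hall : ∀ P : StrC L → Prop, Enforceable T P →
        Cardinal.mk (isoClassesWith T P) = Cardinal.continuum := fun P hP =>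
      le_antisymm (mk_isoClassesWith_le P) (continuum_le_mk_isoClassesWith hT hP hε hV hVn hbad)
    exact .inl ⟨hall, fun hex => hexcl hex hall⟩
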